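/- \textbf{Model.} There are $J$ goods, with price vectors $p\in\mathbb R^J$ (Euclidean norm). Each agent $i$ has an outcome function $Y_i(w,p)\in\mathbb R$, a demand function $D_i(w,p)\in\mathbb R^J$ and a supply function $S_i(w,p)\in\mathbb R^J$ of its own treatment $w\in\{0,1\}$ and the price $p$; write $Z_i=D_i-S_i$. The triples $(Y_i,D_i,S_i)$, $i=1,2,\dots$, are drawn i.i.d. from a distribution $\Theta$ on a family $\mathcal G$ of such triples. The treatments $W_1,\dots,W_n$ are i.i.d. Bernoulli($\pi$), $0<\pi<1$, independent of the triples. For every $n$ and every treatment vector $W\in\{0,1\}^n$ the market price is $$P(W)\in\arg\min_{p\in\mathbb R^J}\Big\|\frac1n\sum_{i=1}^n Z_i(W_i,p)\Big\|,$$ with ties broken in any deterministic way. With $(W_i=a;W_{-i})$ denoting $W$ with its $i$-th coordinate set to $a$, and expectations taken over $W$ only, conditionally on the agents' functions, the average direct and indirect effects are $$\tau_{\rm ADE}=\frac1n\sum_{i=1}^n\mathbb E\big[Y_i(1,P(W_i=1;W_{-i}))-Y_i(0,P(W_i=0;W_{-i}))\big],$$ $$\tau_{\rm AIE}=\frac1n\sum_{i=1}^n\sum_{j\ne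 i}\mathbb E\big[Y_j(W_j,P(W_i=1;W_{-i}))-Y_j(W_j,P(W_i=0;W_{-i}))\big].$$ Let $y(w,p)=\mathbb E[Y_i(w,p)]$, $d(w,p)=\mathbb E[D_i(w,p)]$, $s(w,p)=\mathbb E[S_i(w,p)]$ and $z_\pi(p)=\pi[d(1,p)-s(1,p)]+(1-\pi)[d(0,p)-s(0,p)]$. A mean-field price $p^*_\pi$ is a price at which the expected demand and supply exist and $z_\pi(p^*_\pi)=0$. \textbf{Assumptions.} There are vectors $l,u$ with positive entries, and $\mathcal S=\{p: l\le p\le u\}$, such that: (1) for each good $j$, all agents in $\mathcal G$, all $w\in\{0,1\}$ and all $p\in\mathbb R^J$: $Z_{ij}(w,p)\le 0$ if $p_j\ge u_j$, and $Z_{ij}(w,p)\ge 0$ if $p_j\le l_j$; moreover for each $j$ there is a set of agents of positive $\Theta$-measure for which the first inequality is strict for all such $w,p$, and one for which the second is; (2) for all agents in $\mathcal G$ and $w\in\{0,1\}$, the functions $Y_i(w,\cdot),D_i(w,\cdot),S_i(w,\cdot)$ are twice continuously differentiable in $p$, and on $\mathcal S$ they and their first and second derivatives are bounded by one constant, the same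 for all agents; (3) $\|\nabla_p f(p)\|<1$ (operator norm) for all $p\in\mathcal S$, where $f(p)=z_\pi(p)+p$. \textbf{Theorem.} For all $q$ in a neighbourhood of $\pi$ there is exactly one mean-field price $p^*_q$. The functions $y(w,\cdot), d(w,\cdot), s(w,\cdot)$ are well defined near $p^*_\pi$; the function $\pi y(1,\cdot)+(1-\pi)y(0,\cdot)$ and $z_\pi$ are differentiable at $p^*_\pi$; the Jacobian $\nabla_p z_\pi(p^*_\pi)$ is invertible; and $q\mapsto p^*_q$ is differentiable at $\pi$. As $n\to\infty$, $$\tau_{\rm ADE}\to_p y(1,p^*_\pi)-y(0,p^*_\pi),\qquad \tau_{\rm AIE}\to_p \nabla_p\big[\pi y(1,p)+(1-\pi)y(0,p)\big]^{\top}\Big|_{p=p^*_\pi}\,\frac{d}{d\pi}p^*_\pi .$$ Furthermore $$\frac{d}{d\pi}p^*_\pi=\big(-\nabla_p z_\pi(p)\big)^{-1}\frac{\partial}{\partial\pi}z_\pi(p)\Big|_{p=p^*_\pi},\qquad \frac{\partial}{\partial\pi}z_\pi(p)\Big|_{p=p^*_\pi}=d(1,p^*_\pi)-d(0,p^*_\pi)-\big(s(1,p^*_\pi)-s(0,p^*_\pi)\big).$$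 -/

import Mathlib

open MeasureTheory ProbabilityTheory Filter Topology

noncomputable section

/-- Prices (and quantities) of `J` goods, with the Euclidean norm. -/
abbrev Price (J : ℕ) := EuclideanSpace ℝ (Fin J)

/-- A family `𝒢` of agents.  Each agent has an outcome function, a demand function and a supply
function of its own treatment (`true` is treated, `false` is control) and of the price vector;
the treatments of the others enter only through the price. -/
structure Market (J : ℕ) (𝒢 : Type*) where
  /-- outcome -/
  Y : 𝒢 → Bool → Price J → ℝ
  /-- demand -/
  D : 𝒢 → Bool → Price J → Price J
  /-- supply -/
  S : 𝒢 → Bool → Price J → Price J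

/-- The box `{p : l ≤ p ≤ u}`. -/
def priceBox {J : ℕ} (l u : Price J) : Set (Price J) :=
  {p | ∀ j, l j ≤ p j ∧ p j ≤ u j}

/-- The probability of the assignment `w` when the `n` treatments are independent Bernoulli(`π`). -/
def treatmentProb {n : ℕ} (π : ℝ) (w : Fin n → Bool) : ℝ :=
  ∏ i, if w i = true then π else 1 - π

/-- Expectation of `f W` over a random assignment `W` of `n` independent Bernoulli(`π`)
treatments. -/
def treatmentExp {n : ℕ} (π : ℝ) (f : (Fin n → Bool) → ℝ) : ℝ :=
  ∑ w, treatmentProb π w * f w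

namespace Market

variable {J : ℕ} {𝒢 : Type*}

/-- Excess demand of an agent. -/
def excess (M : Market J 𝒢) (g : 𝒢) (w : Bool) (p : Price J) : Price J :=
  M.D g w p - M.S g w p

/-- Average excess demand of `n` agents `g` under the assignment `w`. -/
def avgExcess (M : Market J 𝒢) {n : ℕ} (g : Fin n → 𝒢) (w : Fin n → Bool) (p : Price J) :
    Price J :=
  (n : ℝ)⁻¹ • ∑ i, M.excess (g i) (w i) p

/-- `P` is a market price rule: for every finite market and every assignment it picks a price that
minimizes the norm of the average excess demand (so `P` also says how ties are broken). -/
def IsPriceRule (M : Market J 𝒢)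
    (P : (n : ℕ) → (Fin n → 𝒢) → (Fin n → Bool) → Price J) : Prop :=
  ∀ (n : ℕ) (g : Fin n → 𝒢) (w : Fin n → Bool) (p : Price J),
    ‖M.avgExcess g w (P n g w)‖ ≤ ‖M.avgExcess g w p‖

/-- Average direct effect in the market with agents `g`, given the agents' functions. -/
def tauADE (M : Market J 𝒢) (P : (n : ℕ) → (Fin n → 𝒢) → (Fin n → Bool) → Price J) (π : ℝ)
    {n : ℕ} (g : Fin n → 𝒢) : ℝ :=
  (n : ℝ)⁻¹ * ∑ i, treatmentExp π fun w =>
    M.Y (g i) true (P n g (Function.update w i true)) -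
      M.Y (g i) false (P n g (Function.update w i false))

/-- Average indirect effect in the market with agents `g`, given the agents' functions. -/
def tauAIE (M : Market J 𝒢) (P : (n : ℕ) → (Fin n → 𝒢) → (Fin n → Bool) → Price J) (π : ℝ)
    {n : ℕ} (g : Fin n → 𝒢) : ℝ :=
  (n : ℝ)⁻¹ * ∑ i, ∑ j ∈ Finset.univ.erase i, treatmentExp π fun w =>
    M.Y (g j) (w j) (P n g (Function.update w i true)) -
      M.Y (g j) (w j) (P n g (Function.update w i false))

/-- Outcomes, demands and supplies are twice continuously differentiable in the price, and they
and their first two derivatives are bounded on the box `[l, u]`, uniformly over the agents. -/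
structure Smooth (M : Market J 𝒢) (l u : Price J) : Prop where
  contDiff_Y : ∀ g w, ContDiff ℝ 2 (M.Y g w)
  contDiff_D : ∀ g w, ContDiff ℝ 2 (M.D g w)
  contDiff_S : ∀ g w, ContDiff ℝ 2 (M.S g w)
  bounded : ∃ C : ℝ, ∀ g w, ∀ p ∈ priceBox l u, ∀ r ≤ 2,
    ‖iteratedFDeriv ℝ r (M.Y g w) p‖ ≤ C ∧
    ‖iteratedFDeriv ℝ r (M.D g w) p‖ ≤ C ∧
    ‖iteratedFDeriv ℝ r (M.S g w) p‖ ≤ C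

variable [MeasurableSpace 𝒢]

/-- At a fixed treatment and price, outcome, demand and supply are measurable in the agent. -/
structure IsMeasurable (M : Market J 𝒢) : Prop where
  measurable_Y : ∀ w p, Measurable fun g => M.Y g w p
  measurable_D : ∀ w p, Measurable fun g => M.D g w p
  measurable_S : ∀ w p, Measurable fun g => M.S g w p

/-- Bounds on prices: no agent has positive excess demand for a good whose price is at or above its
upper bound, nor negative excess demand for a good whose price is at or below its lower bound, and
in both cases the inequality is strict for a set of agents of positive probability. -/
structure HasPriceBounds (M : Market J 𝒢) (Θ : Measure 𝒢) (l u : Price J) : Prop where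
  lower_pos : ∀ j, 0 < l j
  upper_pos : ∀ j, 0 < u j
  upper : ∀ g w p j, u j ≤ p j → M.excess g w p j ≤ 0
  upper_strict : ∀ j, ∃ A : Set 𝒢, MeasurableSet A ∧ 0 < Θ A ∧
    ∀ g ∈ A, ∀ w p, u j ≤ p j → M.excess g w p j < 0
  lower : ∀ g w p j, p j ≤ l j → 0 ≤ M.excess g w p j
  lower_strict : ∀ j, ∃ A : Set 𝒢, MeasurableSet A ∧ 0 < Θ A ∧
    ∀ g ∈ A, ∀ w p, p j ≤ l j → 0 < M.excess g w p j

/-- Expected outcome. -/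
def meanY (M : Market J 𝒢) (Θ : Measure 𝒢) (w : Bool) (p : Price J) : ℝ :=
  ∫ g, M.Y g w p ∂Θ

/-- Expected demand. -/
def meanD (M : Market J 𝒢) (Θ : Measure 𝒢) (w : Bool) (p : Price J) : Price J :=
  ∫ g, M.D g w p ∂Θ

/-- Expected supply. -/
def meanS (M : Market J 𝒢) (Θ : Measure 𝒢) (w : Bool) (p : Price J) : Price J :=
  ∫ g, M.S g w p ∂Θ

/-- Expected excess demand when treatment is assigned with probability `π`. -/
def meanExcess (M : Market J 𝒢) (Θ : Measure 𝒢) (π : ℝ) (p : Price J) : Price J :=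
  π • (M.meanD Θ true p - M.meanS Θ true p) + (1 - π) • (M.meanD Θ false p - M.meanS Θ false p)

/-- `p` is a mean-field price at `π`: expected demand and supply at `p` exist, and the expected
excess demand vanishes. -/
def IsMeanFieldPrice (M : Market J 𝒢) (Θ : Measure 𝒢) (π : ℝ) (p : Price J) : Prop :=
  (∀ w, Integrable (fun g => M.D g w p) Θ ∧ Integrable (fun g => M.S g w p) Θ) ∧
    M.meanExcess Θ π p = 0

end Market

end

/-! The limits come from comparing two clearing equations that differ in one agent's treatment. This
comparison requires that finite markets clear exactly, although a price rule only minimizes a norm.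
Average excess demand points weakly inward beyond every face of the box, so it has a zero
(`exists_zero_of_inward`) and the minimum is zero. Sample excess demand is not known to be a
contraction, so this zero comes from a Brouwer argument, proved here from the change of variables
formula.

In the mean-field market, the derivative bound is uniform by compactness: `p ↦ z_π(p) + p` has a
Lipschitz constant `κ < 1` on the box. A damped version of this map is a contraction of the box into
itself, which gives existence and uniqueness, also for nearby `q`. Moreover `‖z_π(p)‖ ≥ (1 - κ)‖p -
p*‖`, so approximate zeros are close to `p*`, and minus the Jacobian, `H`, is invertible by a
Neumann series. The derivative of `q ↦ p*_q` follows from a direct expansion with quadratic error.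

In a large market, prices lie in the box once the sample contains agents with strict inequalities,
and a uniform law of large numbers puts clearing prices near `p*`. Changing one treatment moves
average excess demand by `O(1/n)`, so the prices after any single change are close to `p*` too. This
gives the direct effect. For the indirect effect, let `p₁`, `q₁` be the prices with agent `i`
treated and untreated. Subtracting the clearing equations and linearizing at `p*` gives `n (p₁ - q₁)
≈ H⁻¹ (Z_i(1,p*) - Z_i(0,p*))`. The outcomes of the others then change in total by about `V (n (p₁ -
q₁))`, with `V` the derivative of the mean outcome (`abs_sum_erase_sub_le`). Averaging over `i`
gives the limit.

The indirect sum can be of order `n` on a bad assignment, so bad assignments must have conditional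
probability `o(1/n)`. A Chernoff bound provides this, and `treatmentFilter` packages such events as
a filter. -/

/-! ### Brouwer's theorem for continuously differentiable fields, by a volume argument. -/

section Brouwer

/-- Extension by zero off a ball of a Lipschitz function vanishing on the sphere. -/
theorem lipschitzWith_extend_zero {E F : Type*} [NormedAddCommGroup E] [NormedSpace ℝ E]
    [NormedAddCommGroup F] {k : E → F} {K : NNReal} {R : ℝ}
    (hk : LipschitzOnWith K k (Metric.closedBall 0 R)) (hk0 : ∀ x, ‖x‖ = R → k x = 0) :
    LipschitzWith K ((Metric.closedBall (0 : E) R).indicator k) := by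
  classical
  have key : ∀ x y, ‖x‖ ≤ R → R < ‖y‖ → ‖k x‖ ≤ K * ‖x - y‖ := by
    intro x y hx hy
    -- The segment from `x` to `y` crosses the sphere, where `k` vanishes, at a point no farther
    -- from `x` than `y` is.
    have hc : ContinuousOn (fun s : ℝ => ‖x + s • (y - x)‖) (Set.Icc 0 1) := by fun_prop
    obtain ⟨s, hs, hsR⟩ := intermediate_value_Icc (zero_le_one' ℝ) hc
      (show R ∈ _ from ⟨by simpa using hx, by simpa using hy.le⟩)
    have h := hk.dist_le_mul x (by simpa using hx) (x + s • (y - x)) (by simpa using hsR.le)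
    rw [hk0 _ hsR, dist_zero_right, dist_eq_norm] at h
    refine h.trans ?_
    gcongr
    rw [sub_add_cancel_left, norm_neg, norm_smul, Real.norm_eq_abs, abs_of_nonneg hs.1,
      norm_sub_rev y x]
    exact mul_le_of_le_one_left (norm_nonneg _) hs.2
  refine LipschitzWith.of_dist_le_mul fun x y => ?_
  rw [dist_eq_norm, dist_eq_norm]
  by_cases hx : ‖x‖ ≤ R <;> by_cases hy : ‖y‖ ≤ R
  · simpa [Set.indicator, hx, hy, dist_eq_norm] using
      hk.dist_le_mul x (by simpa using hx) y (by simpa using hy)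
  · simpa [Set.indicator, hx, hy] using key x y hx (not_le.1 hy)
  · rw [norm_sub_rev x y]
    simpa [Set.indicator, hx, hy] using key y x hy (not_le.1 hx)
  · simp [Set.indicator, hx, hy]
    positivity

variable {E : Type*} [NormedAddCommGroup E] [InnerProductSpace ℝ E] [FiniteDimensional ℝ E]

/-- `det (1 + t A)` is a polynomial in `t` of degree at most `finrank ℝ E`; its value at `t = 1` is
therefore a combination of its values at `finrank ℝ E + 1` nodes, with coefficients that do not
depend on `A`. -/
theorem det_one_add_eq_sum_nodes {ι : Type*} [Fintype ι] [DecidableEq ι] (t : ι → ℝ)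
    (ht : Function.Injective t) (hι : Module.finrank ℝ E < Fintype.card ι) (A : E →L[ℝ] E) :
    (1 + A).det = ∑ i, (Lagrange.basis Finset.univ t i).eval 1 * (1 + t i • A).det := by
  let b := Module.finBasis ℝ E
  let m : Matrix (Fin (Module.finrank ℝ E)) (Fin (Module.finrank ℝ E)) ℝ :=
    LinearMap.toMatrix b b (A : E →ₗ[ℝ] E)
  let one : Matrix (Fin (Module.finrank ℝ E)) (Fin (Module.finrank ℝ E)) ℝ := 1
  let p : Polynomial ℝ := Matrix.det
    ((Polynomial.X : Polynomial ℝ) • m.map Polynomial.C + one.map Polynomial.C)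
  have hp : ∀ s : ℝ, p.eval s = (1 + s • A).det := by
    intro s
    have h1 : (1 + s • A).det = (LinearMap.toMatrix b b ((1 + s • A : E →L[ℝ] E) : E →ₗ[ℝ] E)).det := by
      rw [ContinuousLinearMap.det, LinearMap.det_toMatrix]
    have h2 : LinearMap.toMatrix b b ((1 + s • A : E →L[ℝ] E) : E →ₗ[ℝ] E) = 1 + s • m := by
      rw [ContinuousLinearMap.toLinearMap_add, map_add, ContinuousLinearMap.toLinearMap_smul, map_smul]
      congr 1
      exact LinearMap.toMatrix_one b
    rw [h1, h2]
    change Polynomial.evalRingHom s p = _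
    rw [RingHom.map_det]
    congr 1
    ext i j
    by_cases hij : i = j <;> simp [one, hij, mul_comm s]
    ring
  have hdeg : p.degree < (Finset.univ : Finset ι).card := by
    refine lt_of_le_of_lt Polynomial.degree_le_natDegree ?_
    have := Polynomial.natDegree_det_X_add_C_le m one
    rw [Fintype.card_fin] at this
    exact_mod_cast lt_of_le_of_lt this hι
  have hi := Lagrange.eq_interpolate_of_eval_eq (s := Finset.univ) (v := t)
    (fun i => (1 + t i • A).det) ht.injOn hdeg (fun i _ => hp (t i))
  have h1 := hp 1
  rw [one_smul] at h1
  rw [← h1, hi, Lagrange.interpolate_apply, Polynomial.eval_finsetSum]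
  simp [mul_comm]

/-- By Neumann series, `1 + sA` is invertible for all `s` in `[0, 1]`, so its determinant keeps the
sign it has at `s = 0`. -/
theorem det_one_add_pos (A : E →L[ℝ] E) (hA : ‖A‖ < 1) : 0 < (1 + A).det := by
  have hne : ∀ s ∈ Set.Icc (0 : ℝ) 1, (1 + s • A).det ≠ 0 := by
    intro s hs h0
    have hlt : ‖-(s • A)‖ < 1 := by
      rw [norm_neg, norm_smul, Real.norm_eq_abs, abs_of_nonneg hs.1]
      nlinarith [norm_nonneg A, hs.2]
    have hu : IsUnit (1 + s • A) := by
      simpa using (Units.oneSub _ hlt).isUnit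
    have : IsUnit (1 + s • A).det := by
      have := hu.map (ContinuousLinearMap.toLinearMapRingHom : (E →L[ℝ] E) →+* (E →ₗ[ℝ] E))
      exact this.map LinearMap.det
    exact this.ne_zero h0
  have hc : ContinuousOn (fun s : ℝ => (1 + s • A).det) (Set.Icc 0 1) := by
    apply Continuous.continuousOn
    exact ContinuousLinearMap.continuous_det.comp (by fun_prop)
  by_contra hneg
  push Not at hneg
  have h01 := intermediate_value_Icc' (zero_le_one' ℝ) hc
  have h0 : (fun s : ℝ => (1 + s • A).det) 0 = 1 := by
    simp [ContinuousLinearMap.det]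
  obtain ⟨s, hs, hs0⟩ := h01 (show (0 : ℝ) ∈ _ from ⟨by simpa using hneg, by
    change 0 ≤ (fun s : ℝ => (1 + s • A).det) 0
    rw [h0]; norm_num⟩)
  exact hne s hs hs0

/-- A small multiple of a Lipschitz map vanishing off a ball, added to the identity, maps the ball
onto itself. -/
theorem image_ball_id_add_smul {g : E → E} {K : NNReal} (hg : LipschitzWith K g) {R : ℝ}
    (hout : ∀ x, R ≤ ‖x‖ → g x = 0) {t : ℝ} (ht0 : 0 ≤ t) (ht : t * K < 1) :
    Function.Injective (fun x => x + t • g x) ∧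
      (fun x => x + t • g x) '' Metric.ball 0 R = Metric.ball 0 R := by
  have hA : ApproximatesLinearOn (fun x => x + t • g x)
      ((ContinuousLinearEquiv.refl ℝ E : E ≃L[ℝ] E) : E →L[ℝ] E) Set.univ (t.toNNReal * K) := by
    intro x _ y _
    have h := hg.dist_le_mul x y
    rw [dist_eq_norm, dist_eq_norm] at h
    have : x + t • g x - (y + t • g y) -
        ((ContinuousLinearEquiv.refl ℝ E : E ≃L[ℝ] E) : E →L[ℝ] E) (x - y) = t • (g x - g y) := by
      simp [smul_sub]; abel
    rw [this, norm_smul, Real.norm_eq_abs, abs_of_nonneg ht0]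
    push_cast
    rw [Real.coe_toNNReal t ht0, mul_assoc]
    gcongr
  -- The trivial space is separate because the identity has norm zero there.
  have hc : Subsingleton E ∨ t.toNNReal * K <
      ‖((ContinuousLinearEquiv.refl ℝ E).symm : E →L[ℝ] E)‖₊⁻¹ := by
    rcases subsingleton_or_nontrivial E with h | h
    · exact Or.inl h
    · right
      have : ‖((ContinuousLinearEquiv.refl ℝ E).symm : E →L[ℝ] E)‖₊ = 1 := by
        have : ((ContinuousLinearEquiv.refl ℝ E).symm : E →L[ℝ] E) = ContinuousLinearMap.id ℝ E := rfl
        rw [this]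
        exact ContinuousLinearMap.nnnorm_id
      rw [this, inv_one, ← NNReal.coe_lt_coe]
      push_cast
      rwa [Real.coe_toNNReal t ht0]
  have hinj : Function.Injective (fun x => x + t • g x) := Set.injOn_univ.1 (hA.injOn hc)
  have hsurj : Function.Surjective (fun x => x + t • g x) := hA.surjective hc
  refine ⟨hinj, Set.Subset.antisymm ?_ ?_⟩
  -- Points outside the ball are fixed, so by injectivity no point of the ball can land on one of
  -- them.
  · rintro _ ⟨x, hx, rfl⟩
    by_contra hy
    simp only [Metric.mem_ball, dist_zero_right, not_lt] at hx hy
    have : x = x + t • g x := hinj (by simp [hout _ hy])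
    rw [← this] at hy
    linarith
  · intro y hy
    obtain ⟨x, rfl⟩ := hsurj y
    refine ⟨x, ?_, rfl⟩
    by_contra hx
    simp only [Metric.mem_ball, dist_zero_right, not_lt] at hx hy
    simp only [hout _ hx, smul_zero, add_zero] at hy
    linarith

/-- There is no Lipschitz retraction of a ball onto its boundary sphere, differentiable inside. -/
theorem no_retraction {g : E → E} {K : NNReal} (hg : LipschitzWith K g) {R : ℝ} (hR : 0 < R)
    (hout : ∀ x, R ≤ ‖x‖ → g x = 0) (hdiff : ∀ x ∈ Metric.ball (0 : E) R, DifferentiableAt ℝ g x)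
    (hsph : ∀ x ∈ Metric.ball (0 : E) R, ‖x + g x‖ = R) : False := by
  borelize E
  let μ : Measure E := Measure.addHaar
  let B : Set E := Metric.ball 0 R
  let d := Module.finrank ℝ E
  -- These are `d + 1` distinct nodes with `t i * K < 1`: enough to interpolate a polynomial of
  -- degree at most `d`, and small enough that `x + t i • g x` is a bijection of the ball.
  let t : Fin (d + 1) → ℝ := fun i => (i : ℝ) / ((d + 1) * (K + 1))
  have hden : (0 : ℝ) < (d + 1) * (K + 1) := by positivity
  have htinj : Function.Injective t := by
    intro i j hij
    have : (i : ℝ) = j := by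
      have := congrArg (· * (((d : ℝ) + 1) * (K + 1))) hij
      simpa [t, div_mul_cancel₀ _ hden.ne'] using this
    exact Fin.ext (by exact_mod_cast this)
  have ht0 : ∀ i, 0 ≤ t i := fun i => by positivity
  have htK : ∀ i, t i * K < 1 := by
    intro i
    have hi : (i : ℝ) < d + 1 := by exact_mod_cast i.2
    rw [div_mul_eq_mul_div, div_lt_one hden]
    have : (0 : ℝ) ≤ K := K.2
    nlinarith
  have hnorm : ∀ x, ‖fderiv ℝ g x‖ ≤ K := fun x => norm_fderiv_le_of_lipschitz ℝ hg
  have hpos : ∀ i x, 0 < (1 + t i • fderiv ℝ g x).det := by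
    intro i x
    apply det_one_add_pos
    rw [norm_smul, Real.norm_eq_abs, abs_of_nonneg (ht0 i)]
    exact lt_of_le_of_lt (mul_le_mul_of_nonneg_left (hnorm x) (ht0 i)) (htK i)
  have hder : ∀ i, ∀ x ∈ B, HasFDerivWithinAt (fun x => x + t i • g x)
      (1 + t i • fderiv ℝ g x) B x := by
    intro i x hx
    exact ((hasFDerivAt_id x).add ((hdiff x hx).hasFDerivAt.const_smul (t i))).hasFDerivWithinAt
  -- Change of variables for a bijection of the ball onto itself; positivity of the determinant
  -- removes the absolute value.
  have hvol : ∀ i, ∫ x in B, (1 + t i • fderiv ℝ g x).det ∂μ = μ.real B := by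
    intro i
    obtain ⟨hinj, him⟩ := image_ball_id_add_smul hg hout (ht0 i) (htK i)
    have := integral_image_eq_integral_abs_det_fderiv_smul μ (measurableSet_ball) (hder i)
      hinj.injOn (fun _ => (1 : ℝ))
    rw [him] at this
    simp only [smul_eq_mul, mul_one, integral_const, measureReal_restrict_apply_univ] at this
    rw [this]
    congr 1
    ext x
    rw [abs_of_pos (hpos i x)]
  have hint : ∀ i, IntegrableOn (fun x => (1 + t i • fderiv ℝ g x).det) B μ := by
    intro i
    obtain ⟨hinj, him⟩ := image_ball_id_add_smul hg hout (ht0 i) (htK i)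
    have := (integrableOn_image_iff_integrableOn_abs_det_fderiv_smul μ (measurableSet_ball) (hder i)
      hinj.injOn (fun _ => (1 : ℝ))).1
    rw [him] at this
    have := this (integrableOn_const (by exact measure_ball_lt_top.ne))
    refine this.congr_fun (fun x _ => ?_) measurableSet_ball
    simp [abs_of_pos (hpos i x)]
  -- Since `‖x + g x‖` is constant, the range of the derivative is orthogonal to `x + g x`. An
  -- invertible derivative would have that nonzero vector itself in its range.
  have hzero : ∀ x ∈ B, (1 + fderiv ℝ g x).det = 0 := by
    intro x hx
    by_contra hne
    have hr : HasFDerivAt (fun x => x + g x) (1 + fderiv ℝ g x) x :=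
      (hasFDerivAt_id x).add (hdiff x hx).hasFDerivAt
    have hc : HasFDerivAt (fun x => ‖x + g x‖ ^ 2) (0 : E →L[ℝ] ℝ) x := by
      refine (hasFDerivAt_const (R ^ 2) x).congr_of_eventuallyEq ?_
      filter_upwards [Metric.isOpen_ball.mem_nhds hx] with y hy
      rw [hsph y hy]
    have hn := hr.norm_sq
    have heq := hc.unique hn
    have hbij : Function.Surjective (1 + fderiv ℝ g x : E →L[ℝ] E) := by
      have hu : IsUnit (LinearMap.det ((1 + fderiv ℝ g x : E →L[ℝ] E) : E →ₗ[ℝ] E)) :=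
        isUnit_iff_ne_zero.2 hne
      exact ((Module.End.isUnit_iff _).1 ((LinearMap.isUnit_iff_isUnit_det _).2 hu)).2
    obtain ⟨v, hv⟩ := hbij (x + g x)
    have := congrArg (fun L : E →L[ℝ] ℝ => L v) heq
    simp only [zero_apply, smul_apply,
      ContinuousLinearMap.comp_apply, hv] at this
    simp only [innerSL_apply_apply, real_inner_self_eq_norm_sq, hsph x hx] at this
    have h2 : (2 : ℝ) * R ^ 2 = 0 := by simpa using this.symm
    nlinarith [pow_pos hR 2]
  -- The integral at parameter 1 is the interpolation of its values at the nodes. These all equal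
  -- the volume, and the Lagrange weights sum to one.
  have hsum : ∫ x in B, (1 + fderiv ℝ g x).det ∂μ = μ.real B := by
    have h1 : ∀ x, (1 + fderiv ℝ g x).det = ∑ i, (Lagrange.basis Finset.univ t i).eval 1 *
        (1 + t i • fderiv ℝ g x).det := fun x =>
      det_one_add_eq_sum_nodes t htinj (by simp [d]) _
    simp_rw [h1]
    rw [integral_finsetSum _ (fun i _ => (hint i).const_mul _)]
    simp_rw [integral_const_mul, hvol]
    rw [← Finset.sum_mul, ← Polynomial.eval_finsetSum,
      Lagrange.sum_basis htinj.injOn Finset.univ_nonempty]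
    simp
  rw [setIntegral_congr_fun measurableSet_ball hzero, integral_zero] at hsum
  have : 0 < μ.real B := ENNReal.toReal_pos (Metric.measure_ball_pos μ 0 hR).ne'
    measure_ball_lt_top.ne
  linarith

/-- A continuously differentiable vector field pointing inward on a sphere has a zero in the
ball. -/
theorem exists_zero_of_inner_neg {h : E → E} (hh : ContDiff ℝ 1 h) {R : ℝ} (hR : 0 < R)
    (hin : ∀ x, ‖x‖ = R → inner ℝ x (h x) < 0) : ∃ x, h x = 0 := by
  by_contra! hne
  -- `x + k x` is where the ray from `x` in the direction `-h x` meets the sphere; `lam x` is the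
  -- larger root of `‖x - lam • h x‖ ^ 2 = R ^ 2`. Strict inwardness keeps `disc` positive up to the
  -- sphere, so the square root stays smooth there, and it makes `lam` vanish on the sphere.
  let disc : E → ℝ := fun x => inner ℝ x (h x) ^ 2 + ‖h x‖ ^ 2 * (R ^ 2 - ‖x‖ ^ 2)
  let lam : E → ℝ := fun x => (inner ℝ x (h x) + √(disc x)) / ‖h x‖ ^ 2
  let k : E → E := fun x => -(lam x • h x)
  have hn : ∀ x, 0 < ‖h x‖ ^ 2 := fun x => pow_pos (norm_pos_iff.2 (hne x)) 2
  have hdisc : ∀ x, ‖x‖ ≤ R → 0 < disc x := by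
    intro x hx
    rcases hx.lt_or_eq with hlt | heq
    · have : 0 < R ^ 2 - ‖x‖ ^ 2 := by nlinarith [norm_nonneg x]
      have := mul_pos (hn x) this
      have := sq_nonneg (inner ℝ x (h x))
      simp only [disc]; linarith
    · simp only [disc, heq, sub_self, mul_zero, add_zero]
      exact sq_pos_of_neg (hin x heq)
  have hdC : ContDiff ℝ 1 disc := by
    have h1 : ContDiff ℝ 1 fun x => inner ℝ x (h x) := contDiff_id.inner ℝ hh
    have h2 : ContDiff ℝ 1 fun x => ‖h x‖ ^ 2 := hh.norm_sq ℝ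
    have h3 : ContDiff ℝ 1 fun x : E => ‖x‖ ^ 2 := contDiff_id.norm_sq ℝ
    exact (h1.pow 2).add (h2.mul (contDiff_const.sub h3))
  have hkC : ∀ x, ‖x‖ ≤ R → ContDiffAt ℝ 1 k x := by
    intro x hx
    have h1 : ContDiff ℝ 1 fun x => inner ℝ x (h x) := contDiff_id.inner ℝ hh
    have h2 : ContDiff ℝ 1 fun x => ‖h x‖ ^ 2 := hh.norm_sq ℝ
    exact (((h1.contDiffAt.add (hdC.contDiffAt.sqrt (hdisc x hx).ne')).div h2.contDiffAt
      (hn x).ne').smul hh.contDiffAt).neg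
  obtain ⟨K, hK⟩ := ContDiffOn.exists_lipschitzOnWith (s := Metric.closedBall (0 : E) R) (f := k)
    (n := 1) (fun x hx => (hkC x (by simpa using hx)).contDiffWithinAt) one_ne_zero
    (convex_closedBall 0 R) (isCompact_closedBall 0 R)
  have hk0 : ∀ x, ‖x‖ = R → k x = 0 := by
    intro x hx
    have hd : √(disc x) = -inner ℝ x (h x) := by
      simp only [disc, hx, sub_self, mul_zero, add_zero]
      rw [Real.sqrt_sq_eq_abs, abs_of_neg (hin x hx)]
    simp [k, lam, hd]
  have hg := lipschitzWith_extend_zero hK hk0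
  have hgk : ∀ x ∈ Metric.ball (0 : E) R,
      (Metric.closedBall (0 : E) R).indicator k =ᶠ[𝓝 x] k := by
    intro x hx
    filter_upwards [Metric.isOpen_ball.mem_nhds hx] with y hy
    exact Set.indicator_of_mem (Metric.ball_subset_closedBall hy) k
  refine no_retraction hg hR ?_ ?_ ?_
  · intro x hx
    rcases hx.lt_or_eq with hlt | heq
    · exact Set.indicator_of_notMem (by simpa using hlt) k
    · rw [Set.indicator_of_mem (by simp [heq.symm]), hk0 x heq.symm]
  · intro x hx
    exact (((hkC x (by simpa using (Metric.ball_subset_closedBall hx))).differentiableAt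
      one_ne_zero)).congr_of_eventuallyEq (hgk x hx)
  · intro x hx
    have hxR : ‖x‖ ≤ R := by simpa using (Metric.ball_subset_closedBall hx)
    rw [(hgk x hx).eq_of_nhds]
    have hsq : ‖x + k x‖ ^ 2 = R ^ 2 := by
      have e1 : x + k x = x - lam x • h x := by simp [k, sub_eq_add_neg]
      rw [e1, norm_sub_sq_real, inner_smul_right, norm_smul, mul_pow, Real.norm_eq_abs, sq_abs]
      have e2 : √(disc x) ^ 2 = inner ℝ x (h x) ^ 2 + ‖h x‖ ^ 2 * (R ^ 2 - ‖x‖ ^ 2) :=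
        Real.sq_sqrt (hdisc x hxR).le
      have e3 : lam x * ‖h x‖ ^ 2 = inner ℝ x (h x) + √(disc x) :=
        div_mul_cancel₀ _ (hn x).ne'
      have e4 : ‖h x‖ ^ 2 * (‖x‖ ^ 2 - 2 * (lam x * inner ℝ x (h x)) + lam x ^ 2 * ‖h x‖ ^ 2)
          = ‖h x‖ ^ 2 * R ^ 2 := by
        linear_combination e2 + (lam x * ‖h x‖ ^ 2 - 2 * inner ℝ x (h x)  + (inner ℝ x (h x) + √(disc x))) * e3
      exact mul_left_cancel₀ (hn x).ne' e4
    exact (sq_eq_sq₀ (norm_nonneg _) hR.le).1 hsq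

end Brouwer

/-! ### Zeros of inward-pointing fields on a box. -/

/-- A smooth function of the real line that vanishes exactly on `[a, b]`, is positive to the right
of it, negative to the left of it, and stays at bounded distance from the identity. -/
noncomputable def smoothOvershoot (a b t : ℝ) : ℝ :=
  (t - b) * Real.smoothTransition (t - b) - (a - t) * Real.smoothTransition (a - t)

theorem smoothOvershoot_of_mem {a b t : ℝ} (h1 : a ≤ t) (h2 : t ≤ b) :
    smoothOvershoot a b t = 0 := by
  simp [smoothOvershoot, Real.smoothTransition.zero_of_nonpos (sub_nonpos.2 h1),
    Real.smoothTransition.zero_of_nonpos (sub_nonpos.2 h2)]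

theorem smoothOvershoot_pos {a b t : ℝ} (hab : a < b) (h : b < t) :
    0 < smoothOvershoot a b t := by
  rw [smoothOvershoot, Real.smoothTransition.zero_of_nonpos (x := a - t) (by linarith),
    mul_zero, sub_zero]
  exact mul_pos (by linarith) (Real.smoothTransition.pos_of_pos (by linarith))

theorem smoothOvershoot_neg {a b t : ℝ} (hab : a < b) (h : t < a) :
    smoothOvershoot a b t < 0 := by
  rw [smoothOvershoot, Real.smoothTransition.zero_of_nonpos (x := t - b) (by linarith),
    mul_zero, zero_sub, neg_lt_zero]
  exact mul_pos (by linarith) (Real.smoothTransition.pos_of_pos (by linarith))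

theorem contDiff_smoothOvershoot (a b : ℝ) : ContDiff ℝ 1 (smoothOvershoot a b) := by
  have h := Real.smoothTransition.contDiff (n := 1)
  unfold smoothOvershoot
  exact ((contDiff_id.sub contDiff_const).mul (h.comp (contDiff_id.sub contDiff_const))).sub
    ((contDiff_const.sub contDiff_id).mul (h.comp (contDiff_const.sub contDiff_id)))

/-- `s * smoothTransition s` differs from `max s 0` by at most 1, and only one of the two errors can
push in each direction. The bound makes the auxiliary field of `exists_zero_of_inward` point inward
on a large sphere. -/
theorem abs_smoothOvershoot_sub_le (a b t : ℝ) : |smoothOvershoot a b t - t| ≤ |a| + |b| + 1 := by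
  have key : ∀ s : ℝ, 0 ≤ max s 0 - s * Real.smoothTransition s ∧
      max s 0 - s * Real.smoothTransition s ≤ 1 := by
    intro s
    have h0 := Real.smoothTransition.nonneg s
    have h1 := Real.smoothTransition.le_one s
    rcases le_total s 0 with hs | hs
    · rw [max_eq_right hs, Real.smoothTransition.zero_of_nonpos hs]; norm_num
    · rw [max_eq_left hs]
      rcases le_total 1 s with h | h
      · rw [Real.smoothTransition.one_of_one_le h]; norm_num
      · constructor <;> nlinarith
  have k1 := key (t - b)
  have k2 := key (a - t)
  have hm : |max (t - b) 0 - max (a - t) 0 - t| ≤ |a| + |b| := by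
    have a1 := le_abs_self a
    have a2 := neg_abs_le a
    have b1 := le_abs_self b
    have b2 := neg_abs_le b
    rcases le_total (t - b) 0 with h | h <;> rcases le_total (a - t) 0 with h' | h' <;>
      simp only [max_eq_left, max_eq_right, h, h'] <;> rw [abs_le] <;> constructor <;> linarith
  rw [abs_le] at hm ⊢
  unfold smoothOvershoot
  constructor <;> linarith [k1.1, k1.2, k2.1, k2.2]

theorem priceBox_eq {J : ℕ} (l u : Price J) :
    priceBox l u = (EuclideanSpace.equiv (Fin J) ℝ) ⁻¹' (Set.Icc (l : Fin J → ℝ) u) := by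
  ext p
  simp [priceBox, Set.mem_Icc, Pi.le_def, forall_and]

theorem isCompact_priceBox {J : ℕ} (l u : Price J) : IsCompact (priceBox l u) := by
  rw [priceBox_eq]
  exact (EuclideanSpace.equiv (Fin J) ℝ).toHomeomorph.isCompact_preimage.2 isCompact_Icc

theorem convex_priceBox {J : ℕ} (l u : Price J) : Convex ℝ (priceBox l u) := by
  rw [priceBox_eq]
  exact (convex_Icc _ _).linear_preimage (EuclideanSpace.equiv (Fin J) ℝ).toLinearMap

theorem priceBox_mem_nhds {J : ℕ} {l u p : Price J} (hp : ∀ j, l j < p j ∧ p j < u j) :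
    priceBox l u ∈ 𝓝 p := by
  have : ∀ j, ∀ᶠ x : Price J in 𝓝 p, l j ≤ x j ∧ x j ≤ u j := by
    intro j
    have hc : Tendsto (fun x : Price J => x j) (𝓝 p) (𝓝 (p j)) :=
      (Continuous.tendsto (by fun_prop) p)
    filter_upwards [hc.eventually (eventually_gt_nhds (hp j).1),
      hc.eventually (eventually_lt_nhds (hp j).2)] with x h1 h2
    exact ⟨h1.le, h2.le⟩
  filter_upwards [eventually_all.2 this] with x hx using hx

/-- A continuously differentiable vector field on a box, defined on the whole space, whose
components point inward on the respective faces of the box, has a zero in the box. -/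
theorem exists_zero_of_inward {J : ℕ} {z : Price J → Price J} (hz : ContDiff ℝ 1 z) {l u : Price J}
    (hlu : ∀ j, l j < u j) (hup : ∀ p j, u j ≤ p j → z p j ≤ 0)
    (hlo : ∀ p j, p j ≤ l j → 0 ≤ z p j) : ∃ p ∈ priceBox l u, z p = 0 := by
  -- `σ` maps the space smoothly into the box and sends coordinates beyond a face to that face; it
  -- need not fix the box. At a zero of `z ∘ σ - m`, a coordinate beyond a face would give `z` and
  -- `m` incompatible signs there, so `m`, and with it `z ∘ σ`, vanishes.
  let σ : Price J → Price J := fun x => WithLp.toLp 2 fun j =>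
    l j + (u j - l j) * Real.smoothTransition ((x j - l j) / (u j - l j))
  let m : Price J → Price J := fun x => WithLp.toLp 2 fun j => smoothOvershoot (l j) (u j) (x j)
  have hcoord : ∀ j : Fin J, ContDiff ℝ 1 fun x : Price J => x j := fun j =>
    (contDiff_euclidean.1 contDiff_id) j
  have hσC : ContDiff ℝ 1 σ := by
    rw [contDiff_euclidean]
    intro j
    have h := Real.smoothTransition.contDiff (n := 1)
    exact contDiff_const.add (contDiff_const.mul
      (h.comp (((hcoord j).sub contDiff_const).div_const _)))
  have hmC : ContDiff ℝ 1 m := by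
    rw [contDiff_euclidean]
    intro j
    exact (contDiff_smoothOvershoot _ _).comp (hcoord j)
  have hσmem : ∀ x, σ x ∈ priceBox l u := by
    intro x j
    have h0 := Real.smoothTransition.nonneg ((x j - l j) / (u j - l j))
    have h1 := Real.smoothTransition.le_one ((x j - l j) / (u j - l j))
    have hpos := sub_pos.2 (hlu j)
    simp only [σ]
    constructor <;> nlinarith
  have hσu : ∀ x j, u j ≤ x j → σ x j = u j := by
    intro x j hx
    have hpos := sub_pos.2 (hlu j)
    have : 1 ≤ (x j - l j) / (u j - l j) := by rw [one_le_div hpos]; linarith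
    simp [σ, Real.smoothTransition.one_of_one_le this]
  have hσl : ∀ x j, x j ≤ l j → σ x j = l j := by
    intro x j hx
    have hpos := sub_pos.2 (hlu j)
    have : (x j - l j) / (u j - l j) ≤ 0 := div_nonpos_of_nonpos_of_nonneg (by linarith) hpos.le
    simp [σ, Real.smoothTransition.zero_of_nonpos this]
  obtain ⟨C, hC⟩ := (isCompact_priceBox l u).exists_bound_of_continuousOn hz.continuous.continuousOn
  let B : Price J := WithLp.toLp 2 fun j => |l j| + |u j| + 1
  have hmB : ∀ x, ‖m x - x‖ ≤ ‖B‖ := by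
    intro x
    rw [EuclideanSpace.norm_eq, EuclideanSpace.norm_eq]
    refine Real.sqrt_le_sqrt (Finset.sum_le_sum fun j _ => ?_)
    have h := abs_smoothOvershoot_sub_le (l j) (u j) (x j)
    simp only [m, B, PiLp.sub_apply, Real.norm_eq_abs, sq_abs]
    rw [← sq_abs]
    exact pow_le_pow_left₀ (abs_nonneg _) h 2
  have hin : ∀ x : Price J, ‖x‖ = |C| + ‖B‖ + 1 → inner ℝ x (z (σ x) - m x) < 0 := by
    intro x hx
    have e : z (σ x) - m x = (z (σ x) - (m x - x)) - x := by abel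
    rw [e, inner_sub_right, real_inner_self_eq_norm_sq]
    have h1 := real_inner_le_norm x (z (σ x) - (m x - x))
    have h2 := norm_sub_le (z (σ x)) (m x - x)
    have h3 := hC _ (hσmem x)
    have h4 := le_abs_self C
    have h5 := hmB x
    have h6 : ‖z (σ x) - (m x - x)‖ < ‖x‖ := by linarith
    have h7 : 0 < ‖x‖ := by rw [hx]; positivity
    nlinarith
  obtain ⟨x, hx⟩ := exists_zero_of_inner_neg (h := fun x => z (σ x) - m x)
    ((hz.comp hσC).sub hmC) (by positivity) hin
  have hxj : ∀ j, z (σ x) j = smoothOvershoot (l j) (u j) (x j) := by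
    intro j
    have := congrArg (fun y : Price J => y j) (sub_eq_zero.1 hx)
    simpa [m] using this
  refine ⟨σ x, hσmem x, ?_⟩
  ext j
  rw [hxj j]
  rcases lt_or_ge (u j) (x j) with h | h
  · have h1 := hup (σ x) j (hσu x j h.le).ge
    rw [hxj j] at h1
    linarith [smoothOvershoot_pos (hlu j) h]
  rcases lt_or_ge (x j) (l j) with h' | h'
  · have h1 := hlo (σ x) j (hσl x j h'.le).le
    rw [hxj j] at h1
    linarith [smoothOvershoot_neg (hlu j) h']
  · exact smoothOvershoot_of_mem h' h

/-! ### Families of functions with uniform `C²` bounds, and their means. -/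

/-- A family of twice continuously differentiable functions which are bounded by `C` on `K`
together with their first two derivatives. -/
structure UniformC2 {𝒢 E F : Type*} [NormedAddCommGroup E] [NormedSpace ℝ E] [NormedAddCommGroup F]
    [NormedSpace ℝ F] (X : 𝒢 → E → F) (K : Set E) (C : ℝ) : Prop where
  contDiff : ∀ g, ContDiff ℝ 2 (X g)
  norm_le : ∀ g, ∀ p ∈ K, ‖X g p‖ ≤ C
  norm_fderiv_le : ∀ g, ∀ p ∈ K, ‖fderiv ℝ (X g) p‖ ≤ C
  norm_fderiv_fderiv_le : ∀ g, ∀ p ∈ K, ‖fderiv ℝ (fderiv ℝ (X g)) p‖ ≤ C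

theorem uniformC2_of_iteratedFDeriv {𝒢 E F : Type*} [NormedAddCommGroup E] [NormedSpace ℝ E]
    [NormedAddCommGroup F] [NormedSpace ℝ F] {X : 𝒢 → E → F} {K : Set E} {C : ℝ}
    (hX : ∀ g, ContDiff ℝ 2 (X g))
    (hC : ∀ g, ∀ p ∈ K, ∀ r ≤ 2, ‖iteratedFDeriv ℝ r (X g) p‖ ≤ C) : UniformC2 X K C where
  contDiff := hX
  norm_le g p hp := by simpa using hC g p hp 0 (by norm_num)
  norm_fderiv_le g p hp := by
    have := hC g p hp 1 (by norm_num)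
    rw [← zero_add 1, ← norm_iteratedFDeriv_fderiv] at this
    simpa using this
  norm_fderiv_fderiv_le g p hp := by
    have := hC g p hp 2 le_rfl
    rw [← one_add_one_eq_two, ← norm_iteratedFDeriv_fderiv, ← zero_add 1,
      ← norm_iteratedFDeriv_fderiv] at this
    simpa using this

/-- A map into the continuous linear maps out of a finite-dimensional space is measurable as soon
as it is so pointwise. -/
theorem measurable_clm_of_apply {𝒢 E F : Type*} [MeasurableSpace 𝒢] [NormedAddCommGroup E]
    [NormedSpace ℝ E] [FiniteDimensional ℝ E] [NormedAddCommGroup F] [NormedSpace ℝ F]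
    [FiniteDimensional ℝ F] [MeasurableSpace F] [BorelSpace F] {A : 𝒢 → E →L[ℝ] F}
    (hA : ∀ v, Measurable fun g => A g v) : Measurable A := by
  have := FiniteDimensional.proper ℝ F
  let b := Module.finBasis ℝ E
  let Φ : (Fin (Module.finrank ℝ E) → F) → E →L[ℝ] F := fun y =>
    ∑ i, ContinuousLinearMap.smulRight (LinearMap.toContinuousLinearMap (b.coord i)) (y i)
  have hΦ : Continuous Φ := by
    refine continuous_finsetSum _ fun i _ => ?_
    exact ((ContinuousLinearMap.smulRightL ℝ E F
      (LinearMap.toContinuousLinearMap (b.coord i))).continuous).comp (continuous_apply i)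
  have hAΦ : A = fun g => Φ fun i => A g (b i) := by
    ext g v
    simp only [Φ, FunLike.coe_sum, Finset.sum_apply,
      ContinuousLinearMap.smulRight_apply, LinearMap.coe_toContinuousLinearMap',
      Module.Basis.coord_apply]
    conv_lhs => rw [← b.sum_repr v, map_sum]
    simp
  rw [hAΦ]
  exact hΦ.measurable.comp (measurable_pi_lambda _ fun i => hA _)

/-- Each directional derivative is a pointwise limit of difference quotients with step `1/n`, which
are measurable in the agent. -/
theorem measurable_fderiv_family {𝒢 E F : Type*} [MeasurableSpace 𝒢] [NormedAddCommGroup E]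
    [NormedSpace ℝ E] [FiniteDimensional ℝ E] [NormedAddCommGroup F] [NormedSpace ℝ F]
    [FiniteDimensional ℝ F] [MeasurableSpace F] [BorelSpace F] {X : 𝒢 → E → F}
    (hX : ∀ p, Measurable fun g => X g p) {p : E} (hd : ∀ g, DifferentiableAt ℝ (X g) p) :
    Measurable fun g => fderiv ℝ (X g) p := by
  have := FiniteDimensional.proper ℝ F
  refine measurable_clm_of_apply fun v => ?_
  refine measurable_of_tendsto_metrizable
    (f := fun (n : ℕ) g => (n : ℝ) • (X g (p + (n : ℝ)⁻¹ • v) - X g p)) (fun n => ?_) ?_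
  · exact ((hX _).sub (hX _)).const_smul _
  · rw [tendsto_pi_nhds]
    intro g
    exact ((hd g).hasFDerivAt.lim_real v).comp tendsto_natCast_atTop_atTop

namespace UniformC2

variable {𝒢 E F : Type*} [NormedAddCommGroup E] [NormedSpace ℝ E]
  [NormedAddCommGroup F] [NormedSpace ℝ F] {X : 𝒢 → E → F} {K : Set E} {C : ℝ}

theorem mono (h : UniformC2 X K C) {C' : ℝ} (hC : C ≤ C') : UniformC2 X K C' where
  contDiff := h.contDiff
  norm_le g p hp := (h.norm_le g p hp).trans hC
  norm_fderiv_le g p hp := (h.norm_fderiv_le g p hp).trans hC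
  norm_fderiv_fderiv_le g p hp := (h.norm_fderiv_fderiv_le g p hp).trans hC

theorem sub {X' : 𝒢 → E → F} {C' : ℝ} (h : UniformC2 X K C) (h' : UniformC2 X' K C') :
    UniformC2 (fun g p => X g p - X' g p) K (C + C') := by
  have e : ∀ g, fderiv ℝ (fun p => X g p - X' g p) = fun p => fderiv ℝ (X g) p - fderiv ℝ (X' g) p :=
    fun g => funext fun p => fderiv_fun_sub (((h.contDiff g).differentiable two_ne_zero) p)
      (((h'.contDiff g).differentiable two_ne_zero) p)
  have d : ∀ {X : 𝒢 → E → F} {C : ℝ}, UniformC2 X K C → ∀ g p,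
      DifferentiableAt ℝ (fderiv ℝ (X g)) p := fun h g p =>
    (((h.contDiff g).fderiv_right (m := 1) (by norm_num)).differentiable one_ne_zero) p
  refine ⟨fun g => (h.contDiff g).sub (h'.contDiff g), fun g p hp => ?_, fun g p hp => ?_,
    fun g p hp => ?_⟩
  · exact (norm_sub_le _ _).trans (add_le_add (h.norm_le g p hp) (h'.norm_le g p hp))
  · rw [e]
    exact (norm_sub_le _ _).trans (add_le_add (h.norm_fderiv_le g p hp) (h'.norm_fderiv_le g p hp))
  · rw [e, fderiv_fun_sub (d h g p) (d h' g p)]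
    have h1 := h.norm_fderiv_fderiv_le g p hp
    have h2 := h'.norm_fderiv_fderiv_le g p hp
    exact (norm_sub_le (E := E →L[ℝ] E →L[ℝ] F) _ _).trans (add_le_add h1 h2)

theorem differentiableAt (h : UniformC2 X K C) (g : 𝒢) (p : E) : DifferentiableAt ℝ (X g) p :=
  (h.contDiff g).differentiable two_ne_zero p

theorem norm_sub_le_mul (h : UniformC2 X K C) (hK : Convex ℝ K) (g : 𝒢) {p q : E} (hp : p ∈ K)
    (hq : q ∈ K) : ‖X g p - X g q‖ ≤ C * ‖p - q‖ :=
  hK.norm_image_sub_le_of_norm_fderiv_le (fun x _ => h.differentiableAt g x)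
    (fun x hx => h.norm_fderiv_le g x hx) hq hp

theorem norm_fderiv_sub_le_mul (h : UniformC2 X K C) (hK : Convex ℝ K) (g : 𝒢) {p q : E}
    (hp : p ∈ K) (hq : q ∈ K) : ‖fderiv ℝ (X g) p - fderiv ℝ (X g) q‖ ≤ C * ‖p - q‖ :=
  hK.norm_image_sub_le_of_norm_fderiv_le
    (fun x _ => ((h.contDiff g).fderiv_right (m := 1) (by norm_num)).differentiable one_ne_zero x)
    (fun x hx => h.norm_fderiv_fderiv_le g x hx) hq hp

/-- First order expansion between two points near a third one. -/
theorem norm_sub_sub_fderiv_le (h : UniformC2 X K C) (hK : Convex ℝ K) (g : 𝒢) {p₀ p q : E} {ρ : ℝ}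
    (hp₀ : p₀ ∈ K) (hp : p ∈ K) (hq : q ∈ K) (hpρ : ‖p - p₀‖ ≤ ρ) (hqρ : ‖q - p₀‖ ≤ ρ) :
    ‖X g p - X g q - fderiv ℝ (X g) p₀ (p - q)‖ ≤ C * ρ * ‖p - q‖ := by
  have hC : 0 ≤ C := (norm_nonneg _).trans (h.norm_le g p₀ hp₀)
  -- On the convex set `K ∩ closedBall p₀ ρ` the derivative varies from its value at `p₀` by at most
  -- `C * ρ`. The error is thus proportional to `‖p - q‖`, which matters when `p - q` is far smaller
  -- than the distance to `p₀`.
  refine (hK.inter (convex_closedBall p₀ ρ)).norm_image_sub_le_of_norm_fderiv_le'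
    (fun x _ => h.differentiableAt g x) (fun x hx => ?_) ⟨hq, by simpa [dist_eq_norm] using hqρ⟩
    ⟨hp, by simpa [dist_eq_norm] using hpρ⟩
  refine (h.norm_fderiv_sub_le_mul hK g hx.1 hp₀).trans ?_
  gcongr
  simpa [dist_eq_norm] using hx.2

section Mean

variable [FiniteDimensional ℝ F] [MeasurableSpace F] [BorelSpace F]
  [MeasurableSpace 𝒢] {Θ : Measure 𝒢} [IsProbabilityMeasure Θ]

theorem integrable (h : UniformC2 X K C) (hX : ∀ p, Measurable fun g => X g p) {p : E}
    (hp : p ∈ K) : Integrable (fun g => X g p) Θ := by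
  have := FiniteDimensional.proper ℝ F
  exact Integrable.of_bound (hX p).aestronglyMeasurable C (ae_of_all _ fun g => h.norm_le g p hp)

theorem norm_integral_sub_le_mul (h : UniformC2 X K C) (hX : ∀ p, Measurable fun g => X g p)
    (hK : Convex ℝ K) {p q : E} (hp : p ∈ K) (hq : q ∈ K) :
    ‖(∫ g, X g p ∂Θ) - ∫ g, X g q ∂Θ‖ ≤ C * ‖p - q‖ := by
  rw [← integral_sub (h.integrable hX hp) (h.integrable hX hq)]
  simpa using norm_integral_le_of_norm_le_const (μ := Θ)
    (ae_of_all _ fun g => h.norm_sub_le_mul hK g hp hq)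

variable [FiniteDimensional ℝ E]

theorem integrable_fderiv (h : UniformC2 X K C) (hX : ∀ p, Measurable fun g => X g p) {p : E}
    (hp : p ∈ K) : Integrable (fun g => fderiv ℝ (X g) p) Θ := by
  have := FiniteDimensional.proper ℝ (E →L[ℝ] F)
  exact Integrable.of_bound
    (measurable_fderiv_family hX fun g => h.differentiableAt g p).aestronglyMeasurable C
    (ae_of_all _ fun g => h.norm_fderiv_le g p hp)

theorem norm_integral_fderiv_sub_le_mul (h : UniformC2 X K C)
    (hX : ∀ p, Measurable fun g => X g p) (hK : Convex ℝ K) {p q : E} (hp : p ∈ K) (hq : q ∈ K) :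
    ‖(∫ g, fderiv ℝ (X g) p ∂Θ) - ∫ g, fderiv ℝ (X g) q ∂Θ‖ ≤ C * ‖p - q‖ := by
  rw [← integral_sub (h.integrable_fderiv hX hp) (h.integrable_fderiv hX hq)]
  simpa using norm_integral_le_of_norm_le_const (μ := Θ)
    (ae_of_all _ fun g => h.norm_fderiv_sub_le_mul hK g hp hq)

theorem norm_integral_sub_sub_fderiv_le (h : UniformC2 X K C)
    (hX : ∀ p, Measurable fun g => X g p) (hK : Convex ℝ K) {p₀ p q : E} {ρ : ℝ}
    (hp₀ : p₀ ∈ K) (hp : p ∈ K) (hq : q ∈ K) (hpρ : ‖p - p₀‖ ≤ ρ) (hqρ : ‖q - p₀‖ ≤ ρ) :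
    ‖(∫ g, X g p ∂Θ) - (∫ g, X g q ∂Θ) - (∫ g, fderiv ℝ (X g) p₀ ∂Θ) (p - q)‖ ≤
      C * ρ * ‖p - q‖ := by
  rw [ContinuousLinearMap.integral_apply (h.integrable_fderiv hX hp₀),
    ← integral_sub (h.integrable hX hp) (h.integrable hX hq),
    ← integral_sub (f := fun g => X g p - X g q) ((h.integrable hX hp).sub (h.integrable hX hq))
      ((h.integrable_fderiv hX hp₀).apply_continuousLinearMap _)]
  simpa using norm_integral_le_of_norm_le_const (μ := Θ)
    (ae_of_all _ fun g => h.norm_sub_sub_fderiv_le hK g hp₀ hp hq hpρ hqρ)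

theorem hasFDerivWithinAt_integral (h : UniformC2 X K C) (hX : ∀ p, Measurable fun g => X g p)
    (hK : Convex ℝ K) {p : E} (hp : p ∈ K) :
    HasFDerivWithinAt (fun p => ∫ g, X g p ∂Θ) (∫ g, fderiv ℝ (X g) p ∂Θ) K p := by
  rw [hasFDerivWithinAt_iff_isLittleO, Asymptotics.isLittleO_iff]
  intro c hc
  have hlim : Tendsto (fun q => C * ‖q - p‖) (𝓝[K] p) (𝓝 0) := by
    refine tendsto_nhdsWithin_of_tendsto_nhds ?_
    have : Continuous fun q : E => C * ‖q - p‖ := by fun_prop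
    simpa using this.tendsto p
  filter_upwards [hlim.eventually (ge_mem_nhds hc), self_mem_nhdsWithin] with q hq hqK
  refine (h.norm_integral_sub_sub_fderiv_le hX hK hp hqK hp le_rfl (by simp)).trans ?_
  gcongr

end Mean

end UniformC2

/-! ### Convergence in probability as convergence along a filter. -/

section InProbability

variable {Ω : Type*} [MeasurableSpace Ω]

/-- The filter of the sets of pairs `(n, ω)` which hold with probability tending to one as `n → ∞`
(measured by the outer measure of the complement). -/
def inProbability (μ : Measure Ω) : Filter (ℕ × Ω) where
  sets := {S | Tendsto (fun n => μ {ω | (n, ω) ∉ S}) atTop (𝓝 0)}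
  univ_sets := by simp
  sets_of_superset {S T} hS hST := tendsto_of_tendsto_of_tendsto_of_le_of_le tendsto_const_nhds hS
    (fun _ => zero_le) (fun n => measure_mono fun _ h h' => h (hST h'))
  inter_sets {S T} hS hT := by
    have h : Tendsto (fun n => μ {ω | (n, ω) ∉ S} + μ {ω | (n, ω) ∉ T}) atTop (𝓝 0) := by
      simpa using Tendsto.add hS hT
    refine tendsto_of_tendsto_of_tendsto_of_le_of_le tendsto_const_nhds h (fun _ => zero_le)
      (fun n => le_trans (measure_mono fun ω hω => ?_) (measure_union_le _ _))
    by_contra hc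
    simp only [Set.mem_union, Set.mem_ofPred_eq, not_or, not_not] at hc
    exact hω hc

theorem mem_inProbability {μ : Measure Ω} {S : Set (ℕ × Ω)} :
    S ∈ inProbability μ ↔ Tendsto (fun n => μ {ω | (n, ω) ∉ S}) atTop (𝓝 0) := Iff.rfl

theorem tendsto_fst_inProbability (μ : Measure Ω) :
    Tendsto (fun a : ℕ × Ω => a.1) (inProbability μ) atTop := by
  rw [tendsto_atTop]
  intro N
  refine mem_inProbability.2 (tendsto_const_nhds.congr' ?_)
  filter_upwards [eventually_ge_atTop N] with n hn
  simp [hn]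

/-- Lets events of high probability be combined as eventual statements. No measurability of `f`
enters, which suits price rules that may depend on the agents arbitrarily. -/
theorem tendstoInMeasure_iff_inProbability {μ : Measure Ω} {F : Type*} [PseudoMetricSpace F]
    {f : ℕ → Ω → F} {c : F} :
    TendstoInMeasure μ f atTop (fun _ => c) ↔
      Tendsto (fun a : ℕ × Ω => f a.1 a.2) (inProbability μ) (𝓝 c) := by
  rw [tendstoInMeasure_iff_dist, Metric.tendsto_nhds]
  refine forall₂_congr fun ε hε => ?_
  change _ ↔ {a : ℕ × Ω | dist (f a.1 a.2) c < ε} ∈ inProbability μ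
  rw [mem_inProbability]
  simp

/-- Law of large numbers for a function of an i.i.d. sample. -/
theorem tendsto_sampleMean {𝒢 F : Type*} [MeasurableSpace 𝒢] [NormedAddCommGroup F]
    [NormedSpace ℝ F] [FiniteDimensional ℝ F] [MeasurableSpace F] [BorelSpace F] {Θ : Measure 𝒢}
    [IsProbabilityMeasure Θ] {μ : Measure Ω} [IsProbabilityMeasure μ] {G : ℕ → Ω → 𝒢}
    (hGm : ∀ i, Measurable (G i)) (hGlaw : ∀ i, μ.map (G i) = Θ) (hGindep : iIndepFun G μ)
    {X : 𝒢 → F} (hX : Measurable X) {C : ℝ} (hC : ∀ g, ‖X g‖ ≤ C) :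
    Tendsto (fun a : ℕ × Ω => (a.1 : ℝ)⁻¹ • ∑ i : Fin a.1, X (G i a.2)) (inProbability μ)
      (𝓝 (∫ g, X g ∂Θ)) := by
  have := FiniteDimensional.proper ℝ F
  have hm : ∀ i, Measurable fun ω => X (G i ω) := fun i => hX.comp (hGm i)
  have hae := strong_law_ae (μ := μ) (fun i ω => X (G i ω))
    (Integrable.of_bound (hm 0).aestronglyMeasurable C (ae_of_all _ fun ω => hC _))
    (fun i j hij => (hGindep.indepFun hij).comp hX hX)
    (fun i => IdentDistrib.comp (f := G i) (g := G 0)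
      ⟨(hGm i).aemeasurable, (hGm 0).aemeasurable, by rw [hGlaw, hGlaw]⟩ hX)
  have hmean : ∫ ω, X (G 0 ω) ∂μ = ∫ g, X g ∂Θ := by
    rw [← hGlaw 0, integral_map (hGm 0).aemeasurable hX.aestronglyMeasurable]
  rw [hmean] at hae
  rw [← tendstoInMeasure_iff_inProbability
    (f := fun n ω => (n : ℝ)⁻¹ • ∑ i : Fin n, X (G i ω))]
  refine tendstoInMeasure_of_tendsto_ae (fun n => ?_) ?_
  · have hs : Measurable fun ω => ∑ i : Fin n, X (G i ω) :=
      Finset.measurable_fun_sum _ fun i _ => hm i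
    exact (hs.const_smul (n : ℝ)⁻¹).aestronglyMeasurable
  · filter_upwards [hae] with ω hω
    refine hω.congr fun n => ?_
    rw [Finset.sum_range]

/-- A set of positive probability is eventually hit by an i.i.d. sample. -/
theorem eventually_exists_mem_sample {𝒢 : Type*} [MeasurableSpace 𝒢] {Θ : Measure 𝒢}
    [IsProbabilityMeasure Θ] {μ : Measure Ω} [IsProbabilityMeasure μ] {G : ℕ → Ω → 𝒢}
    (hGm : ∀ i, Measurable (G i)) (hGlaw : ∀ i, μ.map (G i) = Θ) (hGindep : iIndepFun G μ)
    {A : Set 𝒢} (hA : MeasurableSet A) (hpos : 0 < Θ A) :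
    ∀ᶠ a : ℕ × Ω in inProbability μ, ∃ i : Fin a.1, G i a.2 ∈ A := by
  have h := tendsto_sampleMean hGm hGlaw hGindep (X := A.indicator fun _ => (1 : ℝ))
    (measurable_const.indicator hA) (C := 1)
    (fun g => (norm_indicator_le_norm_self _ _).trans (by simp))
  have hp : 0 < ∫ g, A.indicator (fun _ => (1 : ℝ)) g ∂Θ := by
    rw [integral_indicator_const _ hA, smul_eq_mul, mul_one]
    exact ENNReal.toReal_pos hpos.ne' (measure_ne_top _ _)
  filter_upwards [h.eventually (lt_mem_nhds hp)] with a ha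
  by_contra! hc
  have : ∑ i : Fin a.1, A.indicator (fun _ => (1 : ℝ)) (G i a.2) = 0 :=
    Finset.sum_eq_zero fun i _ => Set.indicator_of_notMem (hc i) _
  rw [this, smul_zero] at ha
  exact lt_irrefl _ ha

end InProbability

/-! ### Finite expectations over treatments and a Chernoff bound. -/

section Treatment

variable {π : ℝ} {n : ℕ}

theorem treatmentProb_nonneg (h0 : 0 ≤ π) (h1 : π ≤ 1) (w : Fin n → Bool) :
    0 ≤ treatmentProb π w :=
  Finset.prod_nonneg fun i _ => by split_ifs <;> linarith

/-- Independence in finite form: expanding the product of two-term sums yields one term per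
assignment. -/
theorem treatmentExp_prod (π : ℝ) (f : Fin n → Bool → ℝ) :
    treatmentExp π (fun w => ∏ i, f i (w i)) = ∏ i, (π * f i true + (1 - π) * f i false) := by
  have h := Finset.prod_univ_sum (fun _ : Fin n => (Finset.univ : Finset Bool))
    (fun i b => (if b = true then π else 1 - π) * f i b)
  simp only [Fintype.univ_bool, Finset.mem_singleton, Bool.true_eq_false, not_false_eq_true,
    Finset.sum_insert, Finset.sum_singleton, if_true, Bool.false_eq_true, if_false] at h
  rw [h, treatmentExp]
  refine Finset.sum_congr ?_ fun w _ => ?_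
  · ext w; simp [Fintype.mem_piFinset]
  · rw [treatmentProb, Finset.prod_mul_distrib]

theorem treatmentExp_const (π c : ℝ) : treatmentExp π (fun _ : Fin n → Bool => c) = c := by
  have h := treatmentExp_prod (n := n) π (fun _ _ => 1)
  simp only [Finset.prod_const_one, mul_one, add_sub_cancel, treatmentExp] at h
  rw [treatmentExp, ← Finset.sum_mul, h, one_mul]

theorem treatmentExp_add (π : ℝ) (f g : (Fin n → Bool) → ℝ) :
    treatmentExp π (fun w => f w + g w) = treatmentExp π f + treatmentExp π g := by
  simp [treatmentExp, mul_add, Finset.sum_add_distrib]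

theorem treatmentExp_sub (π : ℝ) (f g : (Fin n → Bool) → ℝ) :
    treatmentExp π (fun w => f w - g w) = treatmentExp π f - treatmentExp π g := by
  simp [treatmentExp, mul_sub, Finset.sum_sub_distrib]

theorem treatmentExp_const_mul (π c : ℝ) (f : (Fin n → Bool) → ℝ) :
    treatmentExp π (fun w => c * f w) = c * treatmentExp π f := by
  simp only [treatmentExp, Finset.mul_sum]
  exact Finset.sum_congr rfl fun w _ => by ring

theorem treatmentExp_sum {ι : Type*} (π : ℝ) (s : Finset ι) (f : ι → (Fin n → Bool) → ℝ) :
    treatmentExp π (fun w => ∑ i ∈ s, f i w) = ∑ i ∈ s, treatmentExp π (f i) := by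
  simp only [treatmentExp, Finset.mul_sum]
  exact Finset.sum_comm

theorem treatmentExp_mono (h0 : 0 ≤ π) (h1 : π ≤ 1) {f g : (Fin n → Bool) → ℝ}
    (h : ∀ w, f w ≤ g w) : treatmentExp π f ≤ treatmentExp π g :=
  Finset.sum_le_sum fun w _ => mul_le_mul_of_nonneg_left (h w) (treatmentProb_nonneg h0 h1 w)

/-- Probability of a set of assignments. -/
noncomputable def treatmentPr (π : ℝ) (S : Set (Fin n → Bool)) : ℝ :=
  treatmentExp π (S.indicator fun _ => 1)

theorem treatmentPr_nonneg (h0 : 0 ≤ π) (h1 : π ≤ 1) (S : Set (Fin n → Bool)) :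
    0 ≤ treatmentPr π S := by
  rw [← treatmentExp_const (n := n) π 0]
  exact treatmentExp_mono h0 h1 fun w => Set.indicator_nonneg (fun _ _ => zero_le_one) w

theorem treatmentPr_mono (h0 : 0 ≤ π) (h1 : π ≤ 1) {S T : Set (Fin n → Bool)} (h : S ⊆ T) :
    treatmentPr π S ≤ treatmentPr π T :=
  treatmentExp_mono h0 h1 fun w => Set.indicator_le_indicator_of_subset h (fun _ => zero_le_one) w

theorem treatmentPr_union_le (h0 : 0 ≤ π) (h1 : π ≤ 1) (S T : Set (Fin n → Bool)) :
    treatmentPr π (S ∪ T) ≤ treatmentPr π S + treatmentPr π T := by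
  classical
  rw [treatmentPr, treatmentPr, treatmentPr, ← treatmentExp_add]
  refine treatmentExp_mono h0 h1 fun w => ?_
  by_cases hS : w ∈ S <;> by_cases hT : w ∈ T <;> simp [Set.indicator, hS, hT]

theorem treatmentPr_empty (π : ℝ) : treatmentPr π (∅ : Set (Fin n → Bool)) = 0 := by
  simp [treatmentPr, treatmentExp]

/-- A function close to `c` on a set of assignments and bounded elsewhere has mean close to `c`. -/
theorem abs_treatmentExp_sub_le (h0 : 0 ≤ π) (h1 : π ≤ 1) {f : (Fin n → Bool) → ℝ} {c ε B : ℝ}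
    (hε : 0 ≤ ε) (S : Set (Fin n → Bool)) (hS : ∀ w ∉ S, |f w - c| ≤ ε)
    (hf : ∀ w, |f w - c| ≤ B) : |treatmentExp π f - c| ≤ ε + B * treatmentPr π S := by
  classical
  have key : ∀ w, |f w - c| ≤ ε + B * S.indicator (fun _ => 1) w := by
    intro w
    by_cases hw : w ∈ S
    · simp only [Set.indicator_of_mem hw, mul_one]; linarith [hf w]
    · simp only [Set.indicator_of_notMem hw, mul_zero]; linarith [hS w hw]
  have e : ε + B * treatmentPr π S = treatmentExp π fun w => ε + B * S.indicator (fun _ => 1) w := by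
    rw [treatmentExp_add, treatmentExp_const, treatmentExp_const_mul, treatmentPr]
  have e2 : treatmentExp π f - c = treatmentExp π fun w => f w - c := by
    rw [treatmentExp_sub, treatmentExp_const]
  rw [e, e2, abs_le]
  constructor
  · rw [neg_le, ← neg_one_mul, ← treatmentExp_const_mul]
    exact treatmentExp_mono h0 h1 fun w => by linarith [(abs_le.1 (key w)).1]
  · exact treatmentExp_mono h0 h1 fun w => (abs_le.1 (key w)).2

/-- Chernoff bound for sums of centered bounded functions of independent treatments. -/
theorem treatmentPr_sum_ge_le (h0 : 0 ≤ π) (h1 : π ≤ 1) {c : ℝ} {x : Fin n → Bool → ℝ}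
    (hx : ∀ i b, |x i b| ≤ c) (hmean : ∀ i, π * x i true + (1 - π) * x i false = 0)
    {ε s : ℝ} (hs0 : 0 ≤ s) (hs : s * c ≤ 1) (hsε : s * c ^ 2 ≤ ε / 2) :
    treatmentPr π {w | ε * n ≤ ∑ i, x i (w i)} ≤ Real.exp (-(s * ε / 2) * n) := by
  have hexp : ∀ i, π * Real.exp (s * x i true) + (1 - π) * Real.exp (s * x i false) ≤
      Real.exp (s * ε / 2) := by
    intro i
    -- From `exp t ≤ 1 + t + t ^ 2` for `|t| ≤ 1`. The linear term then averages to zero, and `1 + y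
    -- ≤ exp y` closes the bound.
    have hb : ∀ b, Real.exp (s * x i b) ≤ 1 + s * x i b + s * ε / 2 := by
      intro b
      have h2 : |s * x i b| ≤ s * c := by
        rw [abs_mul, abs_of_nonneg hs0]; exact mul_le_mul_of_nonneg_left (hx i b) hs0
      have h3 := (abs_le.1 (Real.abs_exp_sub_one_sub_id_le (h2.trans hs))).2
      have h4 : (s * x i b) ^ 2 ≤ (s * c) ^ 2 := sq_le_sq' (abs_le.1 h2).1 (abs_le.1 h2).2
      have h5 : (s * c) ^ 2 ≤ s * ε / 2 := by
        have := mul_le_mul_of_nonneg_left hsε hs0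
        nlinarith
      linarith
    have ht := mul_le_mul_of_nonneg_left (hb true) h0
    have hf := mul_le_mul_of_nonneg_left (hb false) (sub_nonneg.2 h1)
    have := Real.add_one_le_exp (s * ε / 2)
    have hm := congrArg (s * ·) (hmean i)
    simp only [mul_zero] at hm
    nlinarith
  have hmgf : treatmentExp π (fun w : Fin n → Bool => Real.exp (s * ∑ i, x i (w i))) ≤
      Real.exp (s * ε / 2 * n) := by
    simp_rw [Finset.mul_sum, Real.exp_sum]
    rw [treatmentExp_prod π fun i b => Real.exp (s * x i b)]
    refine (Finset.prod_le_prod (fun i _ => ?_) fun i _ => hexp i).trans ?_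
    · have := sub_nonneg.2 h1
      positivity
    · rw [Finset.prod_const, Finset.card_fin, ← Real.exp_nat_mul, mul_comm]
  -- Markov's inequality for the exponential; half of the exponent `s * ε * n` survives the moment
  -- bound.
  have hmk : treatmentPr π {w : Fin n → Bool | ε * n ≤ ∑ i, x i (w i)} ≤
      Real.exp (-(s * ε) * n) *
        treatmentExp π (fun w : Fin n → Bool => Real.exp (s * ∑ i, x i (w i))) := by
    rw [← treatmentExp_const_mul, treatmentPr]
    refine treatmentExp_mono h0 h1 fun w => ?_
    rw [Set.indicator_apply]
    split_ifs with hw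
    swap
    · positivity
    rw [← Real.exp_add]
    refine Real.one_le_exp ?_
    have := mul_le_mul_of_nonneg_left (show ε * n ≤ ∑ i, x i (w i) from hw) hs0
    linarith
  refine hmk.trans ((mul_le_mul_of_nonneg_left hmgf (Real.exp_pos _).le).trans ?_)
  rw [← Real.exp_add]
  refine Real.exp_le_exp.2 (le_of_eq ?_)
  ring

end Treatment

/-! ### Laws of large numbers off assignments of conditional probability `o(1/n)`. -/

section TreatmentFilter

variable {Ω : Type*} {π : ℝ}

/-- The filter of the sets of triples `(n, ω, w)` whose complement has, along `L`, conditional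
probability `o(1 / n)` under the random assignment `w`. -/
def treatmentFilter (L : Filter (ℕ × Ω)) (hπ : π ∈ Set.Icc (0 : ℝ) 1) :
    Filter (Σ a : ℕ × Ω, Fin a.1 → Bool) where
  sets := {S | Tendsto (fun a : ℕ × Ω => (a.1 : ℝ) * treatmentPr π {w | ⟨a, w⟩ ∉ S}) L (𝓝 0)}
  univ_sets := by simp [treatmentPr_empty, tendsto_const_nhds]
  sets_of_superset {S T} hS hST := tendsto_of_tendsto_of_tendsto_of_le_of_le tendsto_const_nhds hS
    (fun _ => mul_nonneg (Nat.cast_nonneg _) (treatmentPr_nonneg hπ.1 hπ.2 _))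
    (fun _ => mul_le_mul_of_nonneg_left
      (treatmentPr_mono hπ.1 hπ.2 fun _ h h' => h (hST h')) (Nat.cast_nonneg _))
  inter_sets {S T} hS hT := by
    have h := Tendsto.add hS hT
    rw [add_zero] at h
    refine tendsto_of_tendsto_of_tendsto_of_le_of_le tendsto_const_nhds h
      (fun _ => mul_nonneg (Nat.cast_nonneg _) (treatmentPr_nonneg hπ.1 hπ.2 _)) (fun a => ?_)
    simp only [← mul_add]
    refine mul_le_mul_of_nonneg_left ((treatmentPr_mono hπ.1 hπ.2 fun w hw => ?_).trans
      (treatmentPr_union_le hπ.1 hπ.2 _ _)) (Nat.cast_nonneg _)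
    by_contra hc
    simp only [Set.mem_union, Set.mem_ofPred_eq, not_or, not_not] at hc
    exact hw hc

theorem mem_treatmentFilter {L : Filter (ℕ × Ω)} {hπ : π ∈ Set.Icc (0 : ℝ) 1}
    {S : Set (Σ a : ℕ × Ω, Fin a.1 → Bool)} : S ∈ treatmentFilter L hπ ↔
      Tendsto (fun a : ℕ × Ω => (a.1 : ℝ) * treatmentPr π {w | ⟨a, w⟩ ∉ S}) L (𝓝 0) := Iff.rfl

theorem tendsto_fst_treatmentFilter (L : Filter (ℕ × Ω)) (hπ : π ∈ Set.Icc (0 : ℝ) 1) :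
    Tendsto Sigma.fst (treatmentFilter L hπ) L := by
  intro S hS
  refine (mem_treatmentFilter (hπ := hπ)).2 (tendsto_const_nhds.congr' ?_)
  filter_upwards [hS] with a ha
  simp [ha, treatmentPr_empty]

theorem tendsto_natCast_mul_exp_neg {r : ℝ} (hr : 0 < r) :
    Tendsto (fun n : ℕ => (n : ℝ) * Real.exp (-r * n)) atTop (𝓝 0) := by
  have h := (Real.tendsto_pow_mul_exp_neg_atTop_nhds_zero 1).comp
    (tendsto_natCast_atTop_atTop.const_mul_atTop hr)
  have h2 := h.const_mul r⁻¹
  rw [mul_zero] at h2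
  refine h2.congr fun n => ?_
  simp only [Function.comp, pow_one, neg_mul]
  field_simp

/-- Averages of centered bounded functions of the treatments tend to zero. -/
theorem tendsto_average_centered {L : Filter (ℕ × Ω)} (hL : Tendsto Prod.fst L atTop)
    (hπ : π ∈ Set.Icc (0 : ℝ) 1) {c : ℝ} (x : ∀ a : ℕ × Ω, Fin a.1 → Bool → ℝ)
    (hx : ∀ a i b, |x a i b| ≤ c) (hmean : ∀ a i, π * x a i true + (1 - π) * x a i false = 0) :
    Tendsto (fun t : Σ a : ℕ × Ω, Fin a.1 → Bool => (t.1.1 : ℝ)⁻¹ * ∑ i, x t.1 i (t.2 i))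
      (treatmentFilter L hπ) (𝓝 0) := by
  rw [Metric.tendsto_nhds]
  intro ε hε
  let c' := max c 1
  have hc' : 0 < c' := lt_of_lt_of_le one_pos (le_max_right _ _)
  have hx' : ∀ a i b, |x a i b| ≤ c' := fun a i b => (hx a i b).trans (le_max_left _ _)
  -- The two entries are the two conditions of `treatmentPr_sum_ge_le`; exponential decay then
  -- absorbs the factor `n`.
  let s := min c'⁻¹ (ε / (2 * c' ^ 2))
  have hs : 0 < s := lt_min (by positivity) (by positivity)
  have hs1 : s * c' ≤ 1 := by
    calc s * c' ≤ c'⁻¹ * c' := by gcongr; exact min_le_left _ _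
      _ = 1 := inv_mul_cancel₀ hc'.ne'
  have hs2 : s * c' ^ 2 ≤ ε / 2 := by
    calc s * c' ^ 2 ≤ ε / (2 * c' ^ 2) * c' ^ 2 := by gcongr; exact min_le_right _ _
      _ = ε / 2 := by field_simp
  have hlim := ((tendsto_natCast_mul_exp_neg (r := s * ε / 2) (by positivity)).comp hL).const_mul 2
  rw [mul_zero] at hlim
  refine mem_treatmentFilter.2 (tendsto_of_tendsto_of_tendsto_of_le_of_le' tendsto_const_nhds hlim
    (Eventually.of_forall fun _ =>
      mul_nonneg (Nat.cast_nonneg _) (treatmentPr_nonneg hπ.1 hπ.2 _)) ?_)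
  filter_upwards [hL.eventually (eventually_gt_atTop 0)] with a ha
  have h1 := treatmentPr_sum_ge_le hπ.1 hπ.2 (hx' a) (hmean a) hs.le hs1 hs2
  have h2 := treatmentPr_sum_ge_le (x := fun i b => -x a i b) hπ.1 hπ.2
    (fun i b => by rw [abs_neg]; exact hx' a i b) (fun i => by linarith [hmean a i]) hs.le hs1 hs2
  have hn : (0 : ℝ) < a.1 := Nat.cast_pos.2 ha
  have hsub : {w : Fin a.1 → Bool | (⟨a, w⟩ : Σ a : ℕ × Ω, Fin a.1 → Bool) ∉
      {t | dist ((t.1.1 : ℝ)⁻¹ * ∑ i, x t.1 i (t.2 i)) 0 < ε}} ⊆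
      {w | ε * a.1 ≤ ∑ i, x a i (w i)} ∪ {w | ε * a.1 ≤ ∑ i, -x a i (w i)} := by
    intro w hw
    simp only [Set.mem_ofPred_eq, not_lt, dist_zero_right, norm_mul, norm_inv, Real.norm_eq_abs,
      abs_of_pos hn] at hw
    rw [inv_mul_eq_div, le_div_iff₀ hn] at hw
    rcases le_abs.1 hw with h | h
    · exact Or.inl h
    · right
      rw [Set.mem_ofPred_eq, Finset.sum_neg_distrib]; exact h
  calc (a.1 : ℝ) * _ ≤ a.1 * (Real.exp (-(s * ε / 2) * a.1) + Real.exp (-(s * ε / 2) * a.1)) := by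
        gcongr
        exact (treatmentPr_mono hπ.1 hπ.2 hsub).trans
          ((treatmentPr_union_le hπ.1 hπ.2 _ _).trans (add_le_add h1 h2))
    _ = _ := by simp only [Function.comp]; ring

/-- Convergence of conditional expectations, for functions which converge off events of
probability `o(1 / n)` and grow at most linearly in `n`. -/
theorem tendsto_treatmentExp {L : Filter (ℕ × Ω)} (hL : Tendsto Prod.fst L atTop)
    (hπ : π ∈ Set.Icc (0 : ℝ) 1) (f : ∀ a : ℕ × Ω, (Fin a.1 → Bool) → ℝ) {c B : ℝ}
    (hf : Tendsto (fun t : Σ a : ℕ × Ω, Fin a.1 → Bool => f t.1 t.2) (treatmentFilter L hπ) (𝓝 c))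
    (hB : ∀ᶠ a in L, ∀ w, |f a w| ≤ B * a.1) :
    Tendsto (fun a => treatmentExp π (f a)) L (𝓝 c) := by
  rw [Metric.tendsto_nhds]
  intro ε hε
  let S : Set (Σ a : ℕ × Ω, Fin a.1 → Bool) := {t | dist (f t.1 t.2) c < ε / 2}
  have hS : S ∈ treatmentFilter L hπ := Metric.tendsto_nhds.1 hf (ε / 2) (by positivity)
  have hlim := (mem_treatmentFilter.1 hS).const_mul (|B| + |c|)
  rw [mul_zero] at hlim
  filter_upwards [hB, hlim.eventually (gt_mem_nhds (show 0 < ε / 2 by positivity)),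
    hL.eventually (eventually_ge_atTop 1)] with a ha hpr hn
  have hn1 : (1 : ℝ) ≤ a.1 := by exact_mod_cast hn
  have h := abs_treatmentExp_sub_le hπ.1 hπ.2 (f := f a) (c := c) (ε := ε / 2)
    (B := (|B| + |c|) * a.1) (by positivity) {w | (⟨a, w⟩ : Σ a : ℕ × Ω, Fin a.1 → Bool) ∉ S}
    (fun w hw => ?_) (fun w => ?_)
  · rw [Real.dist_eq]
    refine lt_of_le_of_lt h ?_
    rw [mul_assoc]
    linarith
  · simp only [S, Set.mem_ofPred_eq, not_not, Real.dist_eq] at hw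
    exact hw.le
  · have h1 := abs_sub (f a w) c
    have h2 := ha w
    have h3 := mul_le_mul_of_nonneg_right (le_abs_self B) (zero_le_one.trans hn1)
    have h4 := mul_le_mul_of_nonneg_left hn1 (abs_nonneg c)
    linarith

/-- Each term splits into its mean over the agent's own treatment, a function of the agent handled
by the law of large numbers for the sample, and a remainder that is centered given the agents,
handled by the Chernoff bound. -/
theorem tendsto_treatmentAverage_real {𝒢 : Type*} [MeasurableSpace 𝒢] [MeasurableSpace Ω]
    {Θ : Measure 𝒢} [IsProbabilityMeasure Θ] {μ : Measure Ω} [IsProbabilityMeasure μ]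
    {G : ℕ → Ω → 𝒢} (hGm : ∀ i, Measurable (G i)) (hGlaw : ∀ i, μ.map (G i) = Θ)
    (hGindep : iIndepFun G μ) (hπ : π ∈ Set.Icc (0 : ℝ) 1) {X : Bool → 𝒢 → ℝ}
    (hX : ∀ b, Measurable (X b)) {C : ℝ} (hC : ∀ b g, |X b g| ≤ C) :
    Tendsto (fun t : Σ a : ℕ × Ω, Fin a.1 → Bool =>
        (t.1.1 : ℝ)⁻¹ * ∑ i : Fin t.1.1, X (t.2 i) (G i t.1.2))
      (treatmentFilter (inProbability μ) hπ)
      (𝓝 (π * (∫ g, X true g ∂Θ) + (1 - π) * ∫ g, X false g ∂Θ)) := by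
  let m : 𝒢 → ℝ := fun g => π * X true g + (1 - π) * X false g
  have hπ' := sub_nonneg.2 hπ.2
  have hm : ∀ g, |m g| ≤ C := by
    intro g
    have h1 := mul_le_mul_of_nonneg_left (hC true g) hπ.1
    have h2 := mul_le_mul_of_nonneg_left (hC false g) hπ'
    refine (abs_add_le _ _).trans ?_
    rw [abs_mul, abs_mul, abs_of_nonneg hπ.1, abs_of_nonneg hπ']
    linarith
  have hL := tendsto_fst_inProbability μ
  have h1 := tendsto_average_centered hL hπ (c := C + C) (fun a i b => X b (G i a.2) - m (G i a.2))
    (fun a i b => (abs_sub _ _).trans (add_le_add (hC _ _) (hm _)))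
    (fun a i => by simp only [m]; ring)
  have hmm : Measurable m := ((hX true).const_mul _).add ((hX false).const_mul _)
  have h2 := (tendsto_sampleMean hGm hGlaw hGindep hmm hm).comp
    (tendsto_fst_treatmentFilter (inProbability μ) hπ)
  have hint : ∀ b, Integrable (X b) Θ := fun b =>
    Integrable.of_bound (hX b).aestronglyMeasurable C (ae_of_all _ (hC b))
  have hmean : ∫ g, m g ∂Θ = π * (∫ g, X true g ∂Θ) + (1 - π) * ∫ g, X false g ∂Θ := by
    rw [integral_add ((hint true).const_mul _) ((hint false).const_mul _), integral_const_mul,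
      integral_const_mul]
  rw [hmean] at h2
  have h3 := h1.add h2
  rw [zero_add] at h3
  refine h3.congr fun t => ?_
  simp only [Function.comp, smul_eq_mul, Finset.sum_sub_distrib]
  ring

theorem tendsto_of_coord {ι F : Type*} [NormedAddCommGroup F] [NormedSpace ℝ F]
    [FiniteDimensional ℝ F] {f : ι → F} {l : Filter ι} {c : F}
    (h : ∀ φ : F →L[ℝ] ℝ, Tendsto (fun x => φ (f x)) l (𝓝 (φ c))) : Tendsto f l (𝓝 c) := by
  let e := (Module.finBasis ℝ F).equivFunL
  rw [e.toHomeomorph.isInducing.tendsto_nhds_iff, tendsto_pi_nhds]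
  intro i
  exact h ((ContinuousLinearMap.proj i).comp (e : F →L[ℝ] Fin (Module.finrank ℝ F) → ℝ))

/-- Law of large numbers for functions of treatment and agent, off events of conditional probability
`o(1 / n)`. -/
theorem tendsto_treatmentAverage {𝒢 F : Type*} [MeasurableSpace 𝒢] [MeasurableSpace Ω]
    [NormedAddCommGroup F] [NormedSpace ℝ F] [FiniteDimensional ℝ F] [MeasurableSpace F]
    [BorelSpace F]
    {Θ : Measure 𝒢} [IsProbabilityMeasure Θ] {μ : Measure Ω} [IsProbabilityMeasure μ]
    {G : ℕ → Ω → 𝒢} (hGm : ∀ i, Measurable (G i)) (hGlaw : ∀ i, μ.map (G i) = Θ)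
    (hGindep : iIndepFun G μ) (hπ : π ∈ Set.Icc (0 : ℝ) 1) {X : Bool → 𝒢 → F}
    (hX : ∀ b, Measurable (X b)) {C : ℝ} (hC : ∀ b g, ‖X b g‖ ≤ C) :
    Tendsto (fun t : Σ a : ℕ × Ω, Fin a.1 → Bool =>
        (t.1.1 : ℝ)⁻¹ • ∑ i : Fin t.1.1, X (t.2 i) (G i t.1.2))
      (treatmentFilter (inProbability μ) hπ)
      (𝓝 (π • (∫ g, X true g ∂Θ) + (1 - π) • ∫ g, X false g ∂Θ)) := by
  have := FiniteDimensional.proper ℝ F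
  have hint : ∀ b, Integrable (X b) Θ := fun b =>
    Integrable.of_bound (hX b).aestronglyMeasurable C (ae_of_all _ (hC b))
  refine tendsto_of_coord fun φ => ?_
  have h := tendsto_treatmentAverage_real hGm hGlaw hGindep hπ (X := fun b g => φ (X b g))
    (fun b => φ.continuous.measurable.comp (hX b)) (C := ‖φ‖ * C)
    (fun b g => (φ.le_opNorm _).trans (mul_le_mul_of_nonneg_left (hC b g) (norm_nonneg _)))
  simp_rw [φ.integral_comp_comm (hint _)] at h
  simpa using h

end TreatmentFilter

/-! ### Zeros by contraction on a box. -/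

/-- A vector field on a box which points inward on the faces and whose sum with the identity is a
contraction has a zero in the box. -/
theorem exists_zero_of_contraction {J : ℕ} {z : Price J → Price J} {l u : Price J}
    (hlu : ∀ j, l j ≤ u j) {κ : ℝ} (hκ0 : 0 ≤ κ) (hκ : κ < 1)
    (hz : ∀ p ∈ priceBox l u, ∀ q ∈ priceBox l u, ‖z p + p - (z q + q)‖ ≤ κ * ‖p - q‖)
    (hup : ∀ p ∈ priceBox l u, ∀ j, p j = u j → z p j ≤ 0)
    (hlo : ∀ p ∈ priceBox l u, ∀ j, p j = l j → 0 ≤ z p j) : ∃ p ∈ priceBox l u, z p = 0 := by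
  classical
  have hlip : ∀ p ∈ priceBox l u, ∀ q ∈ priceBox l u, ‖z p - z q‖ ≤ (1 + κ) * ‖p - q‖ := by
    intro p hp q hq
    have e : z p - z q = (z p + p - (z q + q)) - (p - q) := by abel
    rw [e]
    refine (norm_sub_le _ _).trans ?_
    linarith [hz p hp q hq]
  -- The reciprocal of the Lipschitz constant of `z`. Sliding coordinate `j` of `p` onto a face,
  -- where the sign of `z j` is known, gives `z p j ≤ (1 + κ) * (u j - p j)` and its counterpart
  -- below, so the damped step `p + ε • z p` stays in the box.
  let ε : ℝ := (1 + κ)⁻¹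
  have hε0 : 0 < ε := by positivity
  have hε1 : ε ≤ 1 := inv_le_one_of_one_le₀ (by linarith)
  have hεκ : ε * (1 + κ) = 1 := inv_mul_cancel₀ (by positivity)
  let upd : Price J → Fin J → ℝ → Price J := fun p j t =>
    WithLp.toLp 2 (Function.update (p : Fin J → ℝ) j t)
  have hupd : ∀ p ∈ priceBox l u, ∀ j t, l j ≤ t → t ≤ u j → upd p j t ∈ priceBox l u := by
    intro p hp j t h1 h2 k
    by_cases hk : k = j
    · subst hk; simpa [upd] using ⟨h1, h2⟩
    · simpa [upd, hk] using hp k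
  have hnorm : ∀ (p : Price J) j t, ‖p - upd p j t‖ = |p j - t| := by
    intro p j t
    have : p - upd p j t = EuclideanSpace.single j (p j - t) := by
      ext k
      by_cases hk : k = j
      · subst hk; simp [upd]
      · simp [upd, hk]
    rw [this, PiLp.norm_single, Real.norm_eq_abs]
  have hcomp : ∀ (x y : Price J) j, |x j - y j| ≤ ‖x - y‖ := fun x y j => by
    simpa using PiLp.norm_apply_le (x - y) j
  let T : Price J → Price J := fun p => p + ε • z p
  have hmaps : Set.MapsTo T (priceBox l u) (priceBox l u) := by
    intro p hp j
    have hT : T p j = p j + ε * z p j := by simp [T]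
    have e1 := hlip p hp _ (hupd p hp j (u j) (hlu j) le_rfl)
    have e2 := hup _ (hupd p hp j (u j) (hlu j) le_rfl) j (by simp [upd])
    have e3 := (le_abs_self _).trans (hcomp (z p) (z (upd p j (u j))) j)
    have f1 := hlip p hp _ (hupd p hp j (l j) le_rfl (hlu j))
    have f2 := hlo _ (hupd p hp j (l j) le_rfl (hlu j)) j (by simp [upd])
    have f3 := (neg_abs_le _).trans' (neg_le_neg (hcomp (z p) (z (upd p j (l j))) j))
    rw [hnorm, abs_of_nonpos (by linarith [(hp j).2])] at e1
    rw [hnorm, abs_of_nonneg (by linarith [(hp j).1])] at f1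
    have e4 : ε * z p j ≤ ε * ((1 + κ) * -(p j - u j)) :=
      mul_le_mul_of_nonneg_left (by linarith) hε0.le
    have f4 : ε * (-((1 + κ) * (p j - l j))) ≤ ε * z p j :=
      mul_le_mul_of_nonneg_left (by linarith) hε0.le
    rw [← mul_assoc, hεκ] at e4
    rw [mul_neg, ← mul_assoc, hεκ] at f4
    rw [hT]
    constructor <;> linarith
  have hcon : ContractingWith (1 - ε + ε * κ).toNNReal (hmaps.restrict T _ _) := by
    have h0 : 0 ≤ 1 - ε + ε * κ := by nlinarith
    constructor
    · rw [Real.toNNReal_lt_one]; nlinarith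
    · refine LipschitzWith.of_dist_le_mul fun p q => ?_
      rw [Real.coe_toNNReal _ h0, Subtype.dist_eq, Subtype.dist_eq, dist_eq_norm, dist_eq_norm]
      simp only [Set.MapsTo.val_restrict_apply, T]
      -- The damped map is a convex combination of the identity and the contraction `p ↦ z p + p`.
      have e : (p : Price J) + ε • z p - (q + ε • z q) =
          (1 - ε) • ((p : Price J) - q) + ε • (z p + p - (z q + q)) := by module
      rw [e]
      refine (norm_add_le _ _).trans ?_
      rw [norm_smul, norm_smul, Real.norm_eq_abs, Real.norm_eq_abs, abs_of_pos hε0,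
        abs_of_nonneg (sub_nonneg.2 hε1), add_mul]
      have := mul_le_mul_of_nonneg_left (hz p p.2 q q.2) hε0.le
      linarith
  obtain ⟨p, hp, hfix, -⟩ := ContractingWith.exists_fixedPoint'
    (isCompact_priceBox l u).isComplete hmaps hcon (x := l) (fun j => ⟨le_rfl, hlu j⟩)
    (edist_ne_top _ _)
  refine ⟨p, hp, ?_⟩
  have : ε • z p = 0 := by simpa [T, Function.IsFixedPt] using hfix
  exact (smul_eq_zero.1 this).resolve_left hε0.ne'

/-! ### The mean-field market: existence, uniqueness and differentiability of its price. -/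

namespace Market

variable {J : ℕ} {𝒢 : Type*} {M : Market J 𝒢} {l u : Price J}

theorem Smooth.exists_uniformC2 (hs : M.Smooth l u) : ∃ C : ℝ, 0 ≤ C ∧ ∀ b,
    UniformC2 (fun g => M.Y g b) (priceBox l u) C ∧
    UniformC2 (fun g => M.D g b) (priceBox l u) C ∧
    UniformC2 (fun g => M.S g b) (priceBox l u) C ∧
    UniformC2 (fun g => M.excess g b) (priceBox l u) C := by
  obtain ⟨C, hC⟩ := hs.bounded
  have hle : C ≤ |C| + |C| := by linarith [le_abs_self C, abs_nonneg C]
  -- Doubled because excess demand is a difference; the absolute value is there because nothing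
  -- forces the sign of `C` if there are no agents or the box is empty.
  refine ⟨|C| + |C|, by positivity, fun b => ?_⟩
  have hY : UniformC2 (fun g => M.Y g b) (priceBox l u) C := uniformC2_of_iteratedFDeriv
    (fun g => hs.contDiff_Y g b) fun g p hp r hr => (hC g b p hp r hr).1
  have hD : UniformC2 (fun g => M.D g b) (priceBox l u) C := uniformC2_of_iteratedFDeriv
    (fun g => hs.contDiff_D g b) fun g p hp r hr => (hC g b p hp r hr).2.1
  have hS : UniformC2 (fun g => M.S g b) (priceBox l u) C := uniformC2_of_iteratedFDeriv
    (fun g => hs.contDiff_S g b) fun g p hp r hr => (hC g b p hp r hr).2.2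
  exact ⟨hY.mono hle, hD.mono hle, hS.mono hle,
    (hD.sub hS).mono (by linarith [le_abs_self C])⟩

variable [MeasurableSpace 𝒢]

theorem IsMeasurable.excess (hM : M.IsMeasurable) (b : Bool) (p : Price J) :
    Measurable fun g => M.excess g b p :=
  (hM.measurable_D b p).sub (hM.measurable_S b p)

variable {Θ : Measure 𝒢}

/-- Otherwise, at the price `u`, an agent from the strict set would have excess demand for good `j`
both negative and nonnegative. -/
theorem HasPriceBounds.lower_lt_upper (hb : M.HasPriceBounds Θ l u) (j : Fin J) : l j < u j := by
  by_contra! h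
  obtain ⟨A, -, hA, hneg⟩ := hb.upper_strict j
  obtain ⟨g, hg⟩ := nonempty_of_measure_ne_zero hA.ne'
  exact absurd (hb.lower g true u j h) (not_le.2 (hneg g hg true u le_rfl))

/-- Expected excess demand under a given treatment. -/
noncomputable def meanExcessAt (M : Market J 𝒢) (Θ : Measure 𝒢) (b : Bool) (p : Price J) :
    Price J :=
  ∫ g, M.excess g b p ∂Θ

theorem meanExcessAt_eq {b : Bool} {p : Price J} (hD : Integrable (fun g => M.D g b p) Θ)
    (hS : Integrable (fun g => M.S g b p) Θ) :
    M.meanExcessAt Θ b p = M.meanD Θ b p - M.meanS Θ b p :=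
  integral_sub hD hS

theorem meanExcess_eq {q : ℝ} {p : Price J}
    (h : ∀ b, Integrable (fun g => M.D g b p) Θ ∧ Integrable (fun g => M.S g b p) Θ) :
    M.meanExcess Θ q p = q • M.meanExcessAt Θ true p + (1 - q) • M.meanExcessAt Θ false p := by
  rw [meanExcess, meanExcessAt_eq (h true).1 (h true).2, meanExcessAt_eq (h false).1 (h false).2]

theorem meanExcessAt_apply {b : Bool} {p : Price J}
    (h : Integrable (fun g => M.D g b p) Θ ∧ Integrable (fun g => M.S g b p) Θ) (j : Fin J) :
    M.meanExcessAt Θ b p j = ∫ g, M.excess g b p j ∂Θ :=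
  ((EuclideanSpace.proj j : Price J →L[ℝ] ℝ).integral_comp_comm (h.1.sub h.2)).symm

theorem integrable_excess_apply {b : Bool} {p : Price J}
    (h : Integrable (fun g => M.D g b p) Θ ∧ Integrable (fun g => M.S g b p) Θ) (j : Fin J) :
    Integrable (fun g => M.excess g b p j) Θ :=
  (EuclideanSpace.proj j : Price J →L[ℝ] ℝ).integrable_comp (h.1.sub h.2)

theorem integral_pos_of_pos_on {f : 𝒢 → ℝ} (hf : Integrable f Θ) (h0 : ∀ g, 0 ≤ f g) {A : Set 𝒢}
    (hA : 0 < Θ A) (hpos : ∀ g ∈ A, 0 < f g) : 0 < ∫ g, f g ∂Θ :=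
  (integral_pos_iff_support_of_nonneg h0 hf).2
    (hA.trans_le (measure_mono fun g hg => (hpos g hg).ne'))

theorem HasPriceBounds.meanExcessAt_neg (hb : M.HasPriceBounds Θ l u) {b : Bool} {p : Price J}
    (h : Integrable (fun g => M.D g b p) Θ ∧ Integrable (fun g => M.S g b p) Θ) {j : Fin J}
    (hj : u j ≤ p j) : M.meanExcessAt Θ b p j < 0 := by
  obtain ⟨A, -, hA, hneg⟩ := hb.upper_strict j
  have := integral_pos_of_pos_on (integrable_excess_apply h j).neg
    (fun g => neg_nonneg.2 (hb.upper g b p j hj)) hA (fun g hg => neg_pos.2 (hneg g hg b p hj))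
  simp only [Pi.neg_apply, integral_neg] at this
  rw [meanExcessAt_apply h]
  linarith

theorem HasPriceBounds.meanExcessAt_pos (hb : M.HasPriceBounds Θ l u) {b : Bool} {p : Price J}
    (h : Integrable (fun g => M.D g b p) Θ ∧ Integrable (fun g => M.S g b p) Θ) {j : Fin J}
    (hj : p j ≤ l j) : 0 < M.meanExcessAt Θ b p j := by
  obtain ⟨A, -, hA, hpos⟩ := hb.lower_strict j
  rw [meanExcessAt_apply h]
  exact integral_pos_of_pos_on (integrable_excess_apply h j) (fun g => hb.lower g b p j hj) hA
    (fun g hg => hpos g hg b p hj)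

/-- Mean-field prices lie in the interior of the price box. -/
theorem IsMeanFieldPrice.lower_lt_and_lt_upper (hb : M.HasPriceBounds Θ l u) {q : ℝ} (hq0 : 0 < q)
    (hq1 : q < 1) {p : Price J} (hp : M.IsMeanFieldPrice Θ q p) (j : Fin J) :
    l j < p j ∧ p j < u j := by
  have h := congrArg (fun x : Price J => x j) ((meanExcess_eq hp.1).symm.trans hp.2)
  simp only [PiLp.add_apply, PiLp.smul_apply, smul_eq_mul, PiLp.zero_apply] at h
  have hq1' := sub_pos.2 hq1
  constructor <;> by_contra! hj
  · have h1 := mul_pos hq0 (hb.meanExcessAt_pos (hp.1 true) hj)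
    have h2 := mul_pos hq1' (hb.meanExcessAt_pos (hp.1 false) hj)
    linarith
  · have h1 := mul_neg_of_pos_of_neg hq0 (hb.meanExcessAt_neg (hp.1 true) hj)
    have h2 := mul_neg_of_pos_of_neg hq1' (hb.meanExcessAt_neg (hp.1 false) hj)
    linarith

/-- Expected price derivative of excess demand when treatment is assigned with probability `q`. -/
noncomputable def meanJacobian (M : Market J 𝒢) (Θ : Measure 𝒢) (q : ℝ) (p : Price J) :
    Price J →L[ℝ] Price J :=
  q • (∫ g, fderiv ℝ (M.excess g true) p ∂Θ) + (1 - q) • ∫ g, fderiv ℝ (M.excess g false) p ∂Θ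

/-- Excess demand is bounded below by a multiple of the distance between prices. -/
theorem norm_sub_le_norm_meanExcess_sub {π κ : ℝ}
    (hκ : ∀ p ∈ priceBox l u, ∀ q ∈ priceBox l u,
        ‖M.meanExcess Θ π p + p - (M.meanExcess Θ π q + q)‖ ≤ κ * ‖p - q‖) {p p' : Price J}
    (hp : p ∈ priceBox l u) (hp' : p' ∈ priceBox l u) :
    (1 - κ) * ‖p - p'‖ ≤ ‖M.meanExcess Θ π p - M.meanExcess Θ π p'‖ := by
  have h := hκ p hp p' hp'
  have e : p - p' = (M.meanExcess Θ π p + p - (M.meanExcess Θ π p' + p')) -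
    (M.meanExcess Θ π p - M.meanExcess Θ π p') := by abel
  have := norm_sub_le (M.meanExcess Θ π p + p - (M.meanExcess Θ π p' + p'))
    (M.meanExcess Θ π p - M.meanExcess Θ π p')
  rw [← e] at this
  linarith

variable [IsProbabilityMeasure Θ]

theorem Smooth.integrable (hM : M.IsMeasurable) (hs : M.Smooth l u) {p : Price J}
    (hp : p ∈ priceBox l u) (b : Bool) :
    Integrable (fun g => M.D g b p) Θ ∧ Integrable (fun g => M.S g b p) Θ := by
  obtain ⟨C, -, hC⟩ := hs.exists_uniformC2
  exact ⟨(hC b).2.1.integrable (hM.measurable_D b) hp,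
    (hC b).2.2.1.integrable (hM.measurable_S b) hp⟩

theorem Smooth.hasFDerivWithinAt_meanExcess (hM : M.IsMeasurable) (hs : M.Smooth l u) (q : ℝ)
    {p : Price J} (hp : p ∈ priceBox l u) :
    HasFDerivWithinAt (M.meanExcess Θ q) (M.meanJacobian Θ q p) (priceBox l u) p := by
  obtain ⟨C, -, hC⟩ := hs.exists_uniformC2
  have h : ∀ b, HasFDerivWithinAt (M.meanExcessAt Θ b) (∫ g, fderiv ℝ (M.excess g b) p ∂Θ)
      (priceBox l u) p := fun b =>
    (hC b).2.2.2.hasFDerivWithinAt_integral (hM.excess b) (convex_priceBox l u) hp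
  exact (((h true).const_smul q).add ((h false).const_smul (1 - q))).congr
    (fun x hx => meanExcess_eq (hs.integrable hM hx)) (meanExcess_eq (hs.integrable hM hp))

theorem Smooth.continuousOn_meanJacobian (hM : M.IsMeasurable) (hs : M.Smooth l u) (q : ℝ) :
    ContinuousOn (M.meanJacobian Θ q) (priceBox l u) := by
  obtain ⟨C, hC0, hC⟩ := hs.exists_uniformC2
  have h : ∀ b, ContinuousOn (fun p => ∫ g, fderiv ℝ (M.excess g b) p ∂Θ) (priceBox l u) := by
    intro b
    refine LipschitzOnWith.continuousOn (K := C.toNNReal) (LipschitzOnWith.of_dist_le_mul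
      fun p hp p' hp' => ?_)
    rw [Real.coe_toNNReal _ hC0, dist_eq_norm, dist_eq_norm]
    exact (hC b).2.2.2.norm_integral_fderiv_sub_le_mul (hM.excess b) (convex_priceBox l u) hp hp'
  exact ((h true).const_smul q).add ((h false).const_smul (1 - q))

/-- The contraction constant of the price adjustment map is uniform on the price box. -/
theorem Smooth.exists_contraction (hM : M.IsMeasurable) (hb : M.HasPriceBounds Θ l u)
    (hs : M.Smooth l u) {π : ℝ}
    (hcontr : ∀ p ∈ priceBox l u,
      ‖fderivWithin ℝ (fun q => M.meanExcess Θ π q + q) (priceBox l u) p‖ < 1) :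
    ∃ κ : ℝ, 0 ≤ κ ∧ κ < 1 ∧ (∀ p ∈ priceBox l u, ‖M.meanJacobian Θ π p + 1‖ ≤ κ) ∧
      ∀ p ∈ priceBox l u, ∀ q ∈ priceBox l u,
        ‖M.meanExcess Θ π p + p - (M.meanExcess Θ π q + q)‖ ≤ κ * ‖p - q‖ := by
  have hne : (priceBox l u).Nonempty := ⟨l, fun j => ⟨le_rfl, (hb.lower_lt_upper j).le⟩⟩
  -- A convex set with nonempty interior has unique derivatives, so the derivative in `hcontr` is
  -- the mean Jacobian plus the identity.
  have hint : (interior (priceBox l u)).Nonempty := by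
    refine ⟨WithLp.toLp 2 fun j => (l j + u j) / 2, mem_interior_iff_mem_nhds.2
      (priceBox_mem_nhds fun j => ?_)⟩
    have := hb.lower_lt_upper j
    simp only
    constructor <;> linarith
  have hder : ∀ p ∈ priceBox l u, HasFDerivWithinAt (fun q => M.meanExcess Θ π q + q)
      (M.meanJacobian Θ π p + 1) (priceBox l u) p := fun p hp =>
    (hs.hasFDerivWithinAt_meanExcess hM π hp).add (hasFDerivWithinAt_id p _)
  have hlt : ∀ p ∈ priceBox l u, ‖M.meanJacobian Θ π p + 1‖ < 1 := by
    intro p hp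
    rw [← (hder p hp).fderivWithin (uniqueDiffOn_convex (convex_priceBox l u) hint p hp)]
    exact hcontr p hp
  obtain ⟨p₀, hp₀, hmax⟩ := (isCompact_priceBox l u).exists_isMaxOn hne
    (f := fun p => ‖M.meanJacobian Θ π p + 1‖)
    ((hs.continuousOn_meanJacobian hM π).add continuousOn_const).norm
  refine ⟨_, norm_nonneg _, hlt p₀ hp₀, fun p hp => hmax hp, fun p hp q hq => ?_⟩
  exact (convex_priceBox l u).norm_image_sub_le_of_norm_hasFDerivWithin_le hder
    (fun x hx => hmax hx) hq hp

/-- Expected excess demand is affine in the treatment probability with a slope that is Lipschitz in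
the price. Hence the contraction at `π` persists at nearby probabilities. -/
theorem Smooth.norm_meanExcess_sub_le (hM : M.IsMeasurable) (hs : M.Smooth l u) {C : ℝ}
    (hC : ∀ b, UniformC2 (fun g => M.excess g b) (priceBox l u) C) (π q : ℝ) {p p' : Price J}
    (hp : p ∈ priceBox l u) (hp' : p' ∈ priceBox l u) :
    ‖M.meanExcess Θ q p - M.meanExcess Θ q p' - (M.meanExcess Θ π p - M.meanExcess Θ π p')‖ ≤
      2 * C * |q - π| * ‖p - p'‖ := by
  have h : ∀ b, ‖M.meanExcessAt Θ b p - M.meanExcessAt Θ b p'‖ ≤ C * ‖p - p'‖ := fun b =>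
    (hC b).norm_integral_sub_le_mul (hM.excess b) (convex_priceBox l u) hp hp'
  rw [meanExcess_eq (hs.integrable hM hp), meanExcess_eq (hs.integrable hM hp'),
    meanExcess_eq (hs.integrable hM hp), meanExcess_eq (hs.integrable hM hp')]
  have e : q • M.meanExcessAt Θ true p + (1 - q) • M.meanExcessAt Θ false p -
      (q • M.meanExcessAt Θ true p' + (1 - q) • M.meanExcessAt Θ false p') -
      (π • M.meanExcessAt Θ true p + (1 - π) • M.meanExcessAt Θ false p -
        (π • M.meanExcessAt Θ true p' + (1 - π) • M.meanExcessAt Θ false p')) =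
      (q - π) • ((M.meanExcessAt Θ true p - M.meanExcessAt Θ true p') -
        (M.meanExcessAt Θ false p - M.meanExcessAt Θ false p')) := by module
  rw [e, norm_smul, Real.norm_eq_abs]
  have := mul_le_mul_of_nonneg_left ((norm_sub_le (M.meanExcessAt Θ true p -
    M.meanExcessAt Θ true p') (M.meanExcessAt Θ false p - M.meanExcessAt Θ false p')).trans
    (add_le_add (h true) (h false))) (abs_nonneg (q - π))
  linarith

theorem eventually_existsUnique_isMeanFieldPrice (hM : M.IsMeasurable)
    (hb : M.HasPriceBounds Θ l u) (hs : M.Smooth l u) {π : ℝ} (hπ0 : 0 < π) (hπ1 : π < 1)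
    (hcontr : ∀ p ∈ priceBox l u,
      ‖fderivWithin ℝ (fun q => M.meanExcess Θ π q + q) (priceBox l u) p‖ < 1) :
    ∀ᶠ q in 𝓝 π, ∃! p, M.IsMeanFieldPrice Θ q p := by
  obtain ⟨κ, hκ0, hκ1, -, hκ⟩ := hs.exists_contraction hM hb hcontr
  obtain ⟨C, hC0, hC⟩ := hs.exists_uniformC2
  have hlim : Tendsto (fun q => κ + 2 * C * |q - π|) (𝓝 π) (𝓝 κ) := by
    have : Continuous fun q : ℝ => κ + 2 * C * |q - π| := by fun_prop
    simpa using this.tendsto π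
  filter_upwards [hlim.eventually (gt_mem_nhds hκ1), lt_mem_nhds hπ0, gt_mem_nhds hπ1]
    with q hq hq0 hq1
  have hz : ∀ p ∈ priceBox l u, ∀ p' ∈ priceBox l u,
      ‖M.meanExcess Θ q p + p - (M.meanExcess Θ q p' + p')‖ ≤
        (κ + 2 * C * |q - π|) * ‖p - p'‖ := by
    intro p hp p' hp'
    have e : M.meanExcess Θ q p + p - (M.meanExcess Θ q p' + p') =
        (M.meanExcess Θ π p + p - (M.meanExcess Θ π p' + p')) + (M.meanExcess Θ q p -
          M.meanExcess Θ q p' - (M.meanExcess Θ π p - M.meanExcess Θ π p')) := by abel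
    rw [e, add_mul]
    exact (norm_add_le _ _).trans (add_le_add (hκ p hp p' hp')
      (hs.norm_meanExcess_sub_le hM (fun b => (hC b).2.2.2) π q hp hp'))
  have hq1' := sub_pos.2 hq1
  obtain ⟨p, hp, hp0⟩ := exists_zero_of_contraction (fun j => (hb.lower_lt_upper j).le)
    (by positivity) hq hz
    (fun p hp j hj => by
      have h1 := hb.meanExcessAt_neg (hs.integrable hM hp true) hj.ge
      have h2 := hb.meanExcessAt_neg (hs.integrable hM hp false) hj.ge
      rw [meanExcess_eq (hs.integrable hM hp)]
      simp only [PiLp.add_apply, PiLp.smul_apply, smul_eq_mul]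
      nlinarith)
    (fun p hp j hj => by
      have h1 := hb.meanExcessAt_pos (hs.integrable hM hp true) hj.le
      have h2 := hb.meanExcessAt_pos (hs.integrable hM hp false) hj.le
      rw [meanExcess_eq (hs.integrable hM hp)]
      simp only [PiLp.add_apply, PiLp.smul_apply, smul_eq_mul]
      positivity)
  refine ⟨p, ⟨hs.integrable hM hp, hp0⟩, fun p' hp' => ?_⟩
  -- Strict signs on and beyond the faces exclude zeros elsewhere, so uniqueness in the box is
  -- uniqueness in the whole space.
  have hp'box : p' ∈ priceBox l u := fun j =>
    ⟨(hp'.lower_lt_and_lt_upper hb hq0 hq1 j).1.le, (hp'.lower_lt_and_lt_upper hb hq0 hq1 j).2.le⟩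
  have h := hz p' hp'box p hp
  rw [hp0, hp'.2, zero_add, zero_add] at h
  have : ‖p' - p‖ = 0 := by nlinarith [norm_nonneg (p' - p)]
  exact sub_eq_zero.1 (norm_eq_zero.1 this)

/-- The mean-field price is differentiable in the treatment probability. -/
theorem hasDerivAt_meanFieldPrice (hM : M.IsMeasurable)
    (hb : M.HasPriceBounds Θ l u) (hs : M.Smooth l u) {π κ : ℝ} (hπ0 : 0 < π) (hπ1 : π < 1)
    (hκ1 : κ < 1) (hκ : ∀ p ∈ priceBox l u, ∀ q ∈ priceBox l u,
        ‖M.meanExcess Θ π p + p - (M.meanExcess Θ π q + q)‖ ≤ κ * ‖p - q‖)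
    {pstar : ℝ → Price J} (hp : ∀ᶠ q in 𝓝 π, M.IsMeanFieldPrice Θ q (pstar q))
    {H : Price J ≃L[ℝ] Price J}
    (hH : (H : Price J →L[ℝ] Price J) = -M.meanJacobian Θ π (pstar π)) :
    HasDerivAt pstar (H.symm (M.meanExcessAt Θ true (pstar π) - M.meanExcessAt Θ false (pstar π)))
      π := by
  obtain ⟨C, hC0, hC⟩ := hs.exists_uniformC2
  set b := M.meanExcessAt Θ true (pstar π) - M.meanExcessAt Θ false (pstar π) with hbdef
  clear_value b
  let N := ‖(H.symm : Price J →L[ℝ] Price J)‖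
  -- A Lipschitz constant of `pstar` at `π`: `2 * C` bounds the slope in the probability, and `1 -
  -- κ` is the lower bound on how excess demand separates prices.
  let A := 2 * C / (1 - κ)
  have hκ1' := sub_pos.2 hκ1
  have hA : 0 ≤ A := by positivity
  have hbox : ∀ {q}, 0 < q → q < 1 → M.IsMeanFieldPrice Θ q (pstar q) → pstar q ∈ priceBox l u :=
    fun h0 h1 h j => ⟨(h.lower_lt_and_lt_upper hb h0 h1 j).1.le,
      (h.lower_lt_and_lt_upper hb h0 h1 j).2.le⟩
  have hp0 := hp.self_of_nhds
  have hp0box := hbox hπ0 hπ1 hp0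
  have key : ∀ᶠ q in 𝓝 π, ‖pstar q - pstar π - (q - π) • H.symm b‖ ≤
      N * (C * A * A + 2 * C * A) * |q - π| * |q - π| := by
    filter_upwards [hp, lt_mem_nhds hπ0, gt_mem_nhds hπ1] with q hq hq0 hq1
    have hqbox := hbox hq0 hq1 hq
    let δ : Price J → Price J := fun p => M.meanExcessAt Θ true p - M.meanExcessAt Θ false p
    -- The equilibrium condition at `q`, rewritten at `π` by affinity in the probability.
    have hz : M.meanExcess Θ π (pstar q) = (π - q) • δ (pstar q) := by
      have h0 := hq.2
      rw [meanExcess_eq hq.1] at h0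
      rw [meanExcess_eq hq.1, ← sub_zero (_ + _), ← h0]
      simp only [δ]; module
    have hδ : ‖δ (pstar q)‖ ≤ 2 * C := by
      have h : ∀ b, ‖M.meanExcessAt Θ b (pstar q)‖ ≤ C := fun b => by
        simpa [meanExcessAt] using norm_integral_le_of_norm_le_const (μ := Θ)
          (ae_of_all _ fun g => (hC b).2.2.2.norm_le g _ hqbox)
      exact (norm_sub_le _ _).trans (by linarith [h true, h false])
    have hδsub : ‖δ (pstar q) - b‖ ≤ 2 * C * ‖pstar q - pstar π‖ := by
      have h : ∀ b, ‖M.meanExcessAt Θ b (pstar q) - M.meanExcessAt Θ b (pstar π)‖ ≤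
          C * ‖pstar q - pstar π‖ := fun b =>
        (hC b).2.2.2.norm_integral_sub_le_mul (hM.excess b) (convex_priceBox l u) hqbox hp0box
      have e : δ (pstar q) - b = (M.meanExcessAt Θ true (pstar q) -
        M.meanExcessAt Θ true (pstar π)) - (M.meanExcessAt Θ false (pstar q) -
        M.meanExcessAt Θ false (pstar π)) := by simp only [δ, hbdef]; abel
      rw [e]
      exact (norm_sub_le _ _).trans (by linarith [h true, h false])
    have hlip : ‖pstar q - pstar π‖ ≤ A * |q - π| := by
      have h := norm_sub_le_norm_meanExcess_sub hκ hqbox hp0box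
      rw [hp0.2, sub_zero, hz, norm_smul, Real.norm_eq_abs, abs_sub_comm] at h
      rw [div_mul_eq_mul_div, le_div_iff₀ hκ1']
      have := mul_le_mul_of_nonneg_left hδ (abs_nonneg (q - π))
      linarith
    have htay : ‖M.meanExcess Θ π (pstar q) + H (pstar q - pstar π)‖ ≤
        C * ‖pstar q - pstar π‖ * ‖pstar q - pstar π‖ := by
      have h : ∀ b, ‖M.meanExcessAt Θ b (pstar q) - M.meanExcessAt Θ b (pstar π) -
          (∫ g, fderiv ℝ (M.excess g b) (pstar π) ∂Θ) (pstar q - pstar π)‖ ≤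
          C * ‖pstar q - pstar π‖ * ‖pstar q - pstar π‖ := fun b =>
        (hC b).2.2.2.norm_integral_sub_sub_fderiv_le (hM.excess b) (convex_priceBox l u) hp0box
          hqbox hp0box le_rfl (by simp)
      have hHx : H (pstar q - pstar π) = -M.meanJacobian Θ π (pstar π) (pstar q - pstar π) := by
        have := congrArg (fun L : Price J →L[ℝ] Price J => L (pstar q - pstar π)) hH
        simpa using this
      have h0 := hp0.2
      rw [meanExcess_eq hp0.1] at h0
      have e : M.meanExcess Θ π (pstar q) + H (pstar q - pstar π) =
          π • (M.meanExcessAt Θ true (pstar q) - M.meanExcessAt Θ true (pstar π) -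
            (∫ g, fderiv ℝ (M.excess g true) (pstar π) ∂Θ) (pstar q - pstar π)) +
          (1 - π) • (M.meanExcessAt Θ false (pstar q) - M.meanExcessAt Θ false (pstar π) -
            (∫ g, fderiv ℝ (M.excess g false) (pstar π) ∂Θ) (pstar q - pstar π)) := by
        rw [hHx, meanExcess_eq hq.1, meanJacobian, ← sub_zero (_ + _ + -_), ← h0]
        simp only [add_apply, smul_apply]
        module
      rw [e]
      refine (norm_add_le _ _).trans ?_
      rw [norm_smul, norm_smul, Real.norm_eq_abs, Real.norm_eq_abs, abs_of_pos hπ0,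
        abs_of_pos (sub_pos.2 hπ1)]
      have h1 := mul_le_mul_of_nonneg_left (h true) hπ0.le
      have h2 := mul_le_mul_of_nonneg_left (h false) (sub_pos.2 hπ1).le
      linarith
    -- An exact identity: inside `H.symm` stand the Taylor remainder and the variation of `δ`, both
    -- of order `(q - π) ^ 2`.
    have e : pstar q - pstar π - (q - π) • H.symm b = H.symm ((M.meanExcess Θ π (pstar q) +
        H (pstar q - pstar π)) + (q - π) • (δ (pstar q) - b)) := by
      rw [hz]
      have : (π - q) • δ (pstar q) + H (pstar q - pstar π) + (q - π) • (δ (pstar q) - b) =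
          H (pstar q - pstar π) - (q - π) • b := by module
      rw [this, map_sub, map_smul, ContinuousLinearEquiv.symm_apply_apply]
    rw [e]
    refine ((H.symm : Price J →L[ℝ] Price J).le_opNorm _).trans ?_
    rw [mul_assoc, mul_assoc]
    refine mul_le_mul_of_nonneg_left ?_ (norm_nonneg _)
    refine (norm_add_le _ _).trans ?_
    rw [norm_smul, Real.norm_eq_abs]
    have h1 : C * ‖pstar q - pstar π‖ * ‖pstar q - pstar π‖ ≤
        C * (A * |q - π|) * (A * |q - π|) := by gcongr
    have h2 : |q - π| * ‖δ (pstar q) - b‖ ≤ |q - π| * (2 * C * (A * |q - π|)) := by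
      gcongr
      exact hδsub.trans (by gcongr)
    calc _ ≤ C * (A * |q - π|) * (A * |q - π|) + |q - π| * (2 * C * (A * |q - π|)) :=
          add_le_add (htay.trans h1) h2
      _ = _ := by ring
  rw [hasDerivAt_iff_isLittleO, Asymptotics.isLittleO_iff]
  intro c hc
  have hlim : Tendsto (fun q => N * (C * A * A + 2 * C * A) * |q - π|) (𝓝 π) (𝓝 0) := by
    have : Continuous fun q : ℝ => N * (C * A * A + 2 * C * A) * |q - π| := by fun_prop
    simpa using this.tendsto π
  filter_upwards [key, hlim.eventually (ge_mem_nhds hc)] with q hq hq'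
  refine hq.trans ?_
  rw [Real.norm_eq_abs]
  gcongr

end Market

/-! ### Finite markets: exact clearing and concentration of prices. -/

theorem norm_average_le {F : Type*} [NormedAddCommGroup F] [NormedSpace ℝ F] {n : ℕ} {x : Fin n → F}
    {c : ℝ} (hc : 0 ≤ c) (hx : ∀ i, ‖x i‖ ≤ c) : ‖(n : ℝ)⁻¹ • ∑ i, x i‖ ≤ c := by
  rw [norm_smul, norm_inv, Real.norm_natCast]
  have h := (norm_sum_le Finset.univ x).trans (Finset.sum_le_sum fun i _ => hx i)
  rw [Finset.sum_const, Finset.card_fin, nsmul_eq_mul] at h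
  rcases Nat.eq_zero_or_pos n with rfl | hn
  · simpa using hc
  · have hn' : (0 : ℝ) < n := Nat.cast_pos.2 hn
    rw [inv_mul_le_iff₀ hn']
    exact h

theorem sum_update_sub {A F : Type*} [AddCommGroup F] {n : ℕ} (f : Fin n → A → F) (w : Fin n → A)
    (i : Fin n) (b : A) :
    ∑ j, f j (Function.update w i b j) - ∑ j, f j (w j) = f i b - f i (w i) := by
  rw [← Finset.sum_sub_distrib, Finset.sum_eq_single i]
  · simp
  · intro j _ hj
    simp [hj]
  · simp

namespace Market

variable {J : ℕ} {𝒢 : Type*} {M : Market J 𝒢} {l u : Price J}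

theorem avgExcess_apply {n : ℕ} (g : Fin n → 𝒢) (w : Fin n → Bool) (p : Price J) (j : Fin J) :
    M.avgExcess g w p j = (n : ℝ)⁻¹ * ∑ i, M.excess (g i) (w i) p j := by
  simp [avgExcess]

theorem avgExcess_update {n : ℕ} (g : Fin n → 𝒢) (w : Fin n → Bool) (i : Fin n) (b : Bool)
    (p : Price J) : M.avgExcess g (Function.update w i b) p =
      M.avgExcess g w p + (n : ℝ)⁻¹ • (M.excess (g i) b p - M.excess (g i) (w i) p) := by
  rw [avgExcess, avgExcess, ← smul_add, ← sum_update_sub (fun j c => M.excess (g j) c p) w i b]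
  simp

section

variable [MeasurableSpace 𝒢] {Θ : Measure 𝒢}

/-- Markets clear at every assignment. -/
theorem IsPriceRule.avgExcess_eq_zero {P : (n : ℕ) → (Fin n → 𝒢) → (Fin n → Bool) → Price J}
    (hP : M.IsPriceRule P) (hb : M.HasPriceBounds Θ l u) (hs : M.Smooth l u) {n : ℕ}
    (g : Fin n → 𝒢) (w : Fin n → Bool) : M.avgExcess g w (P n g w) = 0 := by
  have hC : ContDiff ℝ 1 (M.avgExcess g w) := by
    have h : ∀ i, ContDiff ℝ 1 (M.excess (g i) (w i)) := fun i =>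
      ((hs.contDiff_D _ _).sub (hs.contDiff_S _ _)).of_le (by norm_num)
    exact (ContDiff.sum fun i _ => h i).const_smul (n : ℝ)⁻¹
  obtain ⟨p, -, hp⟩ := exists_zero_of_inward hC hb.lower_lt_upper
    (fun p j hj => by
      rw [avgExcess_apply]
      exact mul_nonpos_of_nonneg_of_nonpos (by positivity)
        (Finset.sum_nonpos fun i _ => hb.upper _ _ p j hj))
    (fun p j hj => by
      rw [avgExcess_apply]
      exact mul_nonneg (by positivity) (Finset.sum_nonneg fun i _ => hb.lower _ _ p j hj))
  -- A zero exists, so the minimal norm is zero.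
  have := hP n g w p
  rw [hp, norm_zero] at this
  exact norm_le_zero_iff.1 this

variable [IsProbabilityMeasure Θ] {Ω : Type*} [MeasurableSpace Ω] {μ : Measure Ω}
  [IsProbabilityMeasure μ] {G : ℕ → Ω → 𝒢}

/-- With probability tending to one, the market prices lie in the price box for all assignments. -/
theorem IsPriceRule.eventually_mem_priceBox
    {P : (n : ℕ) → (Fin n → 𝒢) → (Fin n → Bool) → Price J}
    (hP : M.IsPriceRule P) (hb : M.HasPriceBounds Θ l u) (hs : M.Smooth l u)
    (hGm : ∀ i, Measurable (G i)) (hGlaw : ∀ i, μ.map (G i) = Θ) (hGindep : iIndepFun G μ) :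
    ∀ᶠ a : ℕ × Ω in inProbability μ, ∀ w, P a.1 (fun i => G i a.2) w ∈ priceBox l u := by
  choose U hUm hUpos hU using hb.upper_strict
  choose D hDm hDpos hD using hb.lower_strict
  have h1 := fun j => eventually_exists_mem_sample hGm hGlaw hGindep (hUm j) (hUpos j)
  have h2 := fun j => eventually_exists_mem_sample hGm hGlaw hGindep (hDm j) (hDpos j)
  -- The event concerns the agents only, hence serves all assignments at once. On it, a price beyond
  -- a face would give a sum of terms of one sign, one of them strict, contradicting clearing.
  filter_upwards [eventually_all.2 h1, eventually_all.2 h2] with a hu hl w j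
  have h0 := congrArg (fun x : Price J => x j)
    (hP.avgExcess_eq_zero hb hs (fun i : Fin a.1 => G i a.2) w)
  obtain ⟨i, hi⟩ := hu j
  obtain ⟨i', hi'⟩ := hl j
  have hn : (0 : ℝ) < (a.1 : ℝ)⁻¹ := inv_pos.2 (Nat.cast_pos.2 i.pos)
  simp only [avgExcess_apply, PiLp.zero_apply, mul_eq_zero, hn.ne', false_or] at h0
  constructor <;> by_contra! hj
  · refine h0.not_gt (Finset.sum_pos' (fun k _ => ?_) ⟨i', Finset.mem_univ _, ?_⟩)
    · exact hb.lower _ _ _ j hj.le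
    · exact hD j _ hi' _ _ hj.le
  · refine h0.not_lt (Finset.sum_neg' (fun k _ => ?_) ⟨i, Finset.mem_univ _, ?_⟩)
    · exact hb.upper _ _ _ j hj.le
    · exact hU j _ hi _ _ hj.le

variable {π : ℝ} {hπ : π ∈ Set.Icc (0 : ℝ) 1}

/-- Uniform law of large numbers for excess demand on the price box. -/
theorem Smooth.eventually_norm_avgExcess_sub_lt (hM : M.IsMeasurable) (hs : M.Smooth l u)
    (hGm : ∀ i, Measurable (G i)) (hGlaw : ∀ i, μ.map (G i) = Θ) (hGindep : iIndepFun G μ)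
    {ε : ℝ} (hε : 0 < ε) :
    ∀ᶠ t : Σ a : ℕ × Ω, Fin a.1 → Bool in treatmentFilter (inProbability μ) hπ,
      ∀ p ∈ priceBox l u,
        ‖M.avgExcess (fun i : Fin t.1.1 => G i t.1.2) t.2 p - M.meanExcess Θ π p‖ < ε := by
  obtain ⟨C, hC0, hC⟩ := hs.exists_uniformC2
  -- On a ball of this radius sample and expected excess demand each vary by at most `ε / 4`,
  -- leaving `ε / 2` for the finitely many centers.
  obtain ⟨N, hNbox, hNfin, hN⟩ := (isCompact_priceBox l u).finite_cover_balls
    (e := ε / (4 * (C + 1))) (by positivity)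
  have hpt : ∀ q ∈ N, ∀ᶠ t : Σ a : ℕ × Ω, Fin a.1 → Bool in treatmentFilter (inProbability μ) hπ,
      ‖M.avgExcess (fun i : Fin t.1.1 => G i t.1.2) t.2 q - M.meanExcess Θ π q‖ < ε / 2 := by
    intro q hq
    have h := tendsto_treatmentAverage hGm hGlaw hGindep hπ (X := fun b g => M.excess g b q)
      (fun b => hM.excess b q) (fun b g => (hC b).2.2.2.norm_le g q (hNbox hq))
    have e := meanExcess_eq (q := π) (hs.integrable (Θ := Θ) hM (hNbox hq))
    rw [meanExcessAt, meanExcessAt] at e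
    rw [← e] at h
    refine (Metric.tendsto_nhds.1 h (ε / 2) (by positivity)).mono fun t ht => ?_
    rwa [dist_eq_norm] at ht
  filter_upwards [(eventually_all_finite hNfin).2 hpt] with t ht p hp
  obtain ⟨q, hqN, hpq⟩ := Set.mem_iUnion₂.1 (hN hp)
  have hq := hNbox hqN
  rw [Metric.mem_ball, dist_eq_norm, lt_div_iff₀ (by positivity)] at hpq
  have hsmall : C * ‖p - q‖ ≤ ε / 4 := by nlinarith [norm_nonneg (p - q)]
  have h1 : ‖M.avgExcess (fun i : Fin t.1.1 => G i t.1.2) t.2 p -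
      M.avgExcess (fun i : Fin t.1.1 => G i t.1.2) t.2 q‖ ≤ ε / 4 := by
    rw [avgExcess, avgExcess, ← smul_sub, ← Finset.sum_sub_distrib]
    exact norm_average_le (by positivity) fun i =>
      ((hC _).2.2.2.norm_sub_le_mul (convex_priceBox l u) _ hp hq).trans hsmall
  have h2 : ‖M.meanExcess Θ π q - M.meanExcess Θ π p‖ ≤ ε / 4 := by
    have h : ∀ b, ‖M.meanExcessAt Θ b q - M.meanExcessAt Θ b p‖ ≤ ε / 4 := fun b => by
      rw [norm_sub_rev]
      exact ((hC b).2.2.2.norm_integral_sub_le_mul (hM.excess b) (convex_priceBox l u) hp hq).trans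
        hsmall
    rw [meanExcess_eq (hs.integrable hM hp), meanExcess_eq (hs.integrable hM hq)]
    have e : π • M.meanExcessAt Θ true q + (1 - π) • M.meanExcessAt Θ false q -
        (π • M.meanExcessAt Θ true p + (1 - π) • M.meanExcessAt Θ false p) =
        π • (M.meanExcessAt Θ true q - M.meanExcessAt Θ true p) +
        (1 - π) • (M.meanExcessAt Θ false q - M.meanExcessAt Θ false p) := by module
    rw [e]
    refine (norm_add_le _ _).trans ?_
    rw [norm_smul, norm_smul, Real.norm_eq_abs, Real.norm_eq_abs, abs_of_nonneg hπ.1,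
      abs_of_nonneg (sub_nonneg.2 hπ.2)]
    have k1 := mul_le_mul_of_nonneg_left (h true) hπ.1
    have k2 := mul_le_mul_of_nonneg_left (h false) (sub_nonneg.2 hπ.2)
    linarith
  have h3 := ht q hqN
  have e : M.avgExcess (fun i : Fin t.1.1 => G i t.1.2) t.2 p - M.meanExcess Θ π p =
      (M.avgExcess (fun i : Fin t.1.1 => G i t.1.2) t.2 p -
        M.avgExcess (fun i : Fin t.1.1 => G i t.1.2) t.2 q) +
      (M.avgExcess (fun i : Fin t.1.1 => G i t.1.2) t.2 q - M.meanExcess Θ π q) +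
      (M.meanExcess Θ π q - M.meanExcess Θ π p) := by abel
  rw [e]
  refine lt_of_le_of_lt (norm_add₃_le) ?_
  linarith

/-- Market prices are close to the mean-field price, also after changing one treatment. -/
theorem IsPriceRule.eventually_norm_price_sub_le
    {P : (n : ℕ) → (Fin n → 𝒢) → (Fin n → Bool) → Price J}
    (hP : M.IsPriceRule P) (hM : M.IsMeasurable) (hb : M.HasPriceBounds Θ l u) (hs : M.Smooth l u)
    (hGm : ∀ i, Measurable (G i)) (hGlaw : ∀ i, μ.map (G i) = Θ) (hGindep : iIndepFun G μ)
    {κ : ℝ} (hκ1 : κ < 1) (hκ : ∀ p ∈ priceBox l u, ∀ q ∈ priceBox l u,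
        ‖M.meanExcess Θ π p + p - (M.meanExcess Θ π q + q)‖ ≤ κ * ‖p - q‖)
    {p₀ : Price J} (hp₀ : p₀ ∈ priceBox l u) (hz : M.meanExcess Θ π p₀ = 0)
    {ε : ℝ} (hε : 0 < ε) :
    ∀ᶠ t : Σ a : ℕ × Ω, Fin a.1 → Bool in treatmentFilter (inProbability μ) hπ, ∀ i b,
      ‖P t.1.1 (fun i => G i t.1.2) (Function.update t.2 i b) - p₀‖ ≤ ε := by
  obtain ⟨C, hC0, hC⟩ := hs.exists_uniformC2
  have hκ1' := sub_pos.2 hκ1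
  have hL := tendsto_fst_treatmentFilter (inProbability μ) hπ
  have hbox := hL.eventually (hP.eventually_mem_priceBox hb hs hGm hGlaw hGindep)
  have hn : Tendsto (fun t : Σ a : ℕ × Ω, Fin a.1 → Bool => 2 * C * (t.1.1 : ℝ)⁻¹)
      (treatmentFilter (inProbability μ) hπ) (𝓝 0) := by
    have := ((tendsto_inv_atTop_nhds_zero_nat (𝕜 := ℝ)).comp
      ((tendsto_fst_inProbability μ).comp hL)).const_mul (2 * C)
    simpa using this
  filter_upwards [hbox, hs.eventually_norm_avgExcess_sub_lt hM hGm hGlaw hGindep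
    (show 0 < (1 - κ) * ε / 2 by positivity),
    hn.eventually (gt_mem_nhds (show 0 < (1 - κ) * ε / 2 by positivity))] with t ht hu hn' i b
  set p := P t.1.1 (fun i => G i t.1.2) (Function.update t.2 i b) with hp
  have hpbox : p ∈ priceBox l u := ht _
  have h0 := hP.avgExcess_eq_zero hb hs (fun i : Fin t.1.1 => G i t.1.2) (Function.update t.2 i b)
  rw [← hp, avgExcess_update] at h0
  -- The price clears the market with one treatment changed, hence nearly clears the original one.
  -- The uniform law at `t.2` alone therefore covers all changes, with no union bound over agents.
  have h1 : ‖M.avgExcess (fun i : Fin t.1.1 => G i t.1.2) t.2 p‖ ≤ 2 * C * (t.1.1 : ℝ)⁻¹ := by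
    rw [eq_neg_of_add_eq_zero_left h0, norm_neg, norm_smul, norm_inv, Real.norm_natCast, mul_comm]
    refine mul_le_mul_of_nonneg_right ((norm_sub_le _ _).trans ?_) (by positivity)
    have k1 := (hC b).2.2.2.norm_le (G i t.1.2) p hpbox
    have k2 := (hC (t.2 i)).2.2.2.norm_le (G i t.1.2) p hpbox
    linarith
  have h2 := hu p hpbox
  have h3 := norm_sub_le_norm_meanExcess_sub hκ hpbox hp₀
  rw [hz, sub_zero] at h3
  have h4 := norm_sub_norm_le (M.meanExcess Θ π p)
    (M.avgExcess (fun i : Fin t.1.1 => G i t.1.2) t.2 p)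
  rw [norm_sub_rev] at h4
  have h5 : (1 - κ) * ‖p - p₀‖ ≤ (1 - κ) * ε := by linarith
  exact le_of_mul_le_mul_left h5 hκ1'

end

/-! ### First-order expansion of a single indirect effect. -/

/-- The indirect effect of one treatment in a given market, to first order. -/
theorem abs_sum_erase_sub_le {C : ℝ} (hC0 : 0 ≤ C)
    (hY : ∀ b, UniformC2 (fun g => M.Y g b) (priceBox l u) C)
    (hZ : ∀ b, UniformC2 (fun g => M.excess g b) (priceBox l u) C)
    (H : Price J ≃L[ℝ] Price J) (V : Price J →L[ℝ] ℝ) {n : ℕ} (g : Fin n → 𝒢) (w : Fin n → Bool)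
    (i : Fin n) {p₀ p₁ q₁ : Price J} (hp₀ : p₀ ∈ priceBox l u) (hp₁ : p₁ ∈ priceBox l u)
    (hq₁ : q₁ ∈ priceBox l u) {e : ℝ} (he1 : e ≤ 1)
    (heN : ‖(H.symm : Price J →L[ℝ] Price J)‖ * ((C + 1) * e) ≤ 1 / 2)
    (hpe : ‖p₁ - p₀‖ ≤ e) (hqe : ‖q₁ - p₀‖ ≤ e)
    (hA : ‖(n : ℝ)⁻¹ • ∑ j, fderiv ℝ (M.excess (g j) (w j)) p₀ + (H : Price J →L[ℝ] Price J)‖ ≤ e)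
    (hB : ‖(n : ℝ)⁻¹ • ∑ j, fderiv ℝ (M.Y (g j) (w j)) p₀ - V‖ ≤ e)
    (hp₁z : M.avgExcess g (Function.update w i true) p₁ = 0)
    (hq₁z : M.avgExcess g (Function.update w i false) q₁ = 0) :
    |∑ j ∈ Finset.univ.erase i, (M.Y (g j) (w j) p₁ - M.Y (g j) (w j) q₁) -
        V (H.symm (M.excess (g i) true p₀ - M.excess (g i) false p₀))| ≤
      ((C + 1) * (12 * ‖(H.symm : Price J →L[ℝ] Price J)‖ * C) +
        ‖V‖ * (‖(H.symm : Price J →L[ℝ] Price J)‖ *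
          (4 * C + (C + 1) * (12 * ‖(H.symm : Price J →L[ℝ] Price J)‖ * C))) + 2 * C) * e := by
  set N := ‖(H.symm : Price J →L[ℝ] Price J)‖ with hNdef
  set R := 12 * N * C with hR
  have hN0 : 0 ≤ N := norm_nonneg _
  have he0 : 0 ≤ e := (norm_nonneg _).trans hpe
  have hn : (0 : ℝ) < n := Nat.cast_pos.2 i.pos
  have hK := convex_priceBox l u
  set d := p₁ - q₁ with hd
  set x := M.excess (g i) true p₀ - M.excess (g i) false p₀ with hx
  set A := (n : ℝ)⁻¹ • ∑ j, fderiv ℝ (M.excess (g j) (w j)) p₀ with hAdef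
  set B := (n : ℝ)⁻¹ • ∑ j, fderiv ℝ (M.Y (g j) (w j)) p₀ with hBdef
  set Δ := M.avgExcess g w p₁ - M.avgExcess g w q₁ with hΔ
  have hd2 : ‖d‖ ≤ 2 * e := by
    have : d = (p₁ - p₀) - (q₁ - p₀) := by rw [hd]; abel
    rw [this]
    exact (norm_sub_le _ _).trans (by linarith)
  have hΔA : ‖Δ - A d‖ ≤ C * e * ‖d‖ := by
    have : Δ - A d = (n : ℝ)⁻¹ • ∑ j, (M.excess (g j) (w j) p₁ - M.excess (g j) (w j) q₁ -
        fderiv ℝ (M.excess (g j) (w j)) p₀ d) := by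
      rw [Finset.sum_sub_distrib, Finset.sum_sub_distrib, smul_sub, smul_sub, hΔ, hAdef]
      simp [avgExcess]
    rw [this]
    exact norm_average_le (by positivity) fun j =>
      (hZ _).norm_sub_sub_fderiv_le hK (g j) hp₀ hp₁ hq₁ hpe hqe
  have hYB : |(n : ℝ)⁻¹ * ∑ j, (M.Y (g j) (w j) p₁ - M.Y (g j) (w j) q₁) - B d| ≤
      C * e * ‖d‖ := by
    have : (n : ℝ)⁻¹ * ∑ j, (M.Y (g j) (w j) p₁ - M.Y (g j) (w j) q₁) - B d =
        (n : ℝ)⁻¹ • ∑ j, (M.Y (g j) (w j) p₁ - M.Y (g j) (w j) q₁ -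
        fderiv ℝ (M.Y (g j) (w j)) p₀ d) := by
      simp [hBdef, Finset.sum_sub_distrib, mul_sub]
    rw [this, ← Real.norm_eq_abs]
    exact norm_average_le (by positivity) fun j =>
      (hY _).norm_sub_sub_fderiv_le hK (g j) hp₀ hp₁ hq₁ hpe hqe
  -- Difference of the two clearing equations, times `n`. Only agent `i`'s terms remain beside `Δ`,
  -- and moving their prices to `p₀` costs `C * e` twice plus `C * ‖d‖`.
  have hnΔ : ‖(n : ℝ) • Δ + x‖ ≤ 4 * C * e := by
    rw [avgExcess_update] at hp₁z hq₁z
    have h1 := congrArg ((n : ℝ) • ·) hp₁z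
    have h2 := congrArg ((n : ℝ) • ·) hq₁z
    simp only [smul_add, smul_smul, mul_inv_cancel₀ hn.ne', one_smul, smul_zero] at h1 h2
    have e1 : (n : ℝ) • Δ + x = -(M.excess (g i) true p₁ - M.excess (g i) true p₀) +
        (M.excess (g i) false q₁ - M.excess (g i) false p₀) +
        (M.excess (g i) (w i) p₁ - M.excess (g i) (w i) q₁) := by
      rw [hΔ, hx, smul_sub, eq_neg_of_add_eq_zero_left h1, eq_neg_of_add_eq_zero_left h2]
      abel
    rw [e1]
    refine norm_add₃_le.trans ?_
    rw [norm_neg]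
    have k1 := (hZ true).norm_sub_le_mul hK (g i) hp₁ hp₀
    have k2 := (hZ false).norm_sub_le_mul hK (g i) hq₁ hp₀
    have k3 := (hZ (w i)).norm_sub_le_mul hK (g i) hp₁ hq₁
    have m1 := mul_le_mul_of_nonneg_left hpe hC0
    have m2 := mul_le_mul_of_nonneg_left hqe hC0
    have m3 := mul_le_mul_of_nonneg_left hd2 hC0
    linarith
  have hnH : ‖(n : ℝ) • H d - x‖ ≤ 4 * C * e + (C + 1) * e * (n * ‖d‖) := by
    have e1 : (n : ℝ) • H d - x = -((n : ℝ) • Δ + x) + (n : ℝ) • (Δ - A d) +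
        (n : ℝ) • (A + (H : Price J →L[ℝ] Price J)) d := by
      simp only [add_apply, ContinuousLinearEquiv.coe_coe]
      module
    rw [e1]
    refine norm_add₃_le.trans ?_
    rw [norm_neg, norm_smul, norm_smul, Real.norm_natCast]
    have k1 := mul_le_mul_of_nonneg_left hΔA hn.le
    have k2 := mul_le_mul_of_nonneg_left (((A + (H : Price J →L[ℝ] Price J)).le_opNorm d).trans
      (mul_le_mul_of_nonneg_right hA (norm_nonneg d))) hn.le
    linarith
  have hxle : ‖x‖ ≤ 2 * C := by
    have k1 := (hZ true).norm_le (g i) p₀ hp₀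
    have k2 := (hZ false).norm_le (g i) p₀ hp₀
    exact (norm_sub_le _ _).trans (by linarith)
  have hnd : ‖(n : ℝ) • d - H.symm x‖ ≤ N * (4 * C * e + (C + 1) * e * (n * ‖d‖)) := by
    have e1 : (n : ℝ) • d - H.symm x = H.symm ((n : ℝ) • H d - x) := by
      rw [map_sub H.symm ((n : ℝ) • H d), map_smul, ContinuousLinearEquiv.symm_apply_apply]
    rw [e1]
    exact ((H.symm : Price J →L[ℝ] Price J).le_opNorm _).trans
      (mul_le_mul_of_nonneg_left hnH hN0)
  -- A priori bound on the scaled price change. By `heN` the error term carrying `n * ‖d‖` is at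
  -- most half of it and is absorbed; doubling `2 * N * C + 4 * N * C` gives `R`.
  have hndR : n * ‖d‖ ≤ R := by
    have k0 : ‖(n : ℝ) • d‖ = n * ‖d‖ := by rw [norm_smul, Real.norm_natCast]
    have k1 := norm_le_norm_add_norm_sub' ((n : ℝ) • d) (H.symm x)
    have k2 : ‖H.symm x‖ ≤ N * (2 * C) :=
      ((H.symm : Price J →L[ℝ] Price J).le_opNorm _).trans (mul_le_mul_of_nonneg_left hxle hN0)
    have k3 : N * ((C + 1) * e) * (n * ‖d‖) ≤ 1 / 2 * (n * ‖d‖) :=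
      mul_le_mul_of_nonneg_right heN (by positivity)
    have k4 : N * (4 * C * e) ≤ N * (4 * C * 1) := by gcongr
    rw [k0] at k1
    rw [hR]
    linarith
  have hR0 : 0 ≤ R := by positivity
  have hCe : (C + 1) * e * (n * ‖d‖) ≤ (C + 1) * e * R := by gcongr
  have hYV : |∑ j, (M.Y (g j) (w j) p₁ - M.Y (g j) (w j) q₁) - V ((n : ℝ) • d)| ≤
      (C + 1) * e * R := by
    refine le_trans ?_ hCe
    have e1 : ∑ j, (M.Y (g j) (w j) p₁ - M.Y (g j) (w j) q₁) - V ((n : ℝ) • d) =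
        n * ((n : ℝ)⁻¹ * ∑ j, (M.Y (g j) (w j) p₁ - M.Y (g j) (w j) q₁) - B d) +
          n * (B - V) d := by
      rw [map_smul, sub_apply, smul_eq_mul]
      field_simp
      ring
    rw [e1]
    refine (abs_add_le _ _).trans ?_
    rw [abs_mul, abs_mul, abs_of_pos hn]
    have k1 := mul_le_mul_of_nonneg_left hYB hn.le
    have k2 := mul_le_mul_of_nonneg_left (((B - V).le_opNorm d).trans
      (mul_le_mul_of_nonneg_right hB (norm_nonneg d))) hn.le
    rw [Real.norm_eq_abs] at k2
    linarith
  have hVV : |V ((n : ℝ) • d) - V (H.symm x)| ≤ ‖V‖ * (N * (4 * C * e + (C + 1) * e * R)) := by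
    rw [← map_sub, ← Real.norm_eq_abs]
    refine (V.le_opNorm _).trans (mul_le_mul_of_nonneg_left (hnd.trans ?_) (norm_nonneg _))
    exact mul_le_mul_of_nonneg_left (add_le_add le_rfl hCe) hN0
  -- The term of agent `i`, excluded from the indirect effect but present in the full sum, is
  -- negligible.
  have hown : |M.Y (g i) (w i) p₁ - M.Y (g i) (w i) q₁| ≤ 2 * C * e := by
    have k1 := (hY (w i)).norm_sub_le_mul hK (g i) hp₁ hq₁
    have k2 := mul_le_mul_of_nonneg_left hd2 hC0
    rw [Real.norm_eq_abs] at k1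
    linarith
  have hsum := Finset.add_sum_erase Finset.univ
    (fun j => M.Y (g j) (w j) p₁ - M.Y (g j) (w j) q₁) (Finset.mem_univ i)
  have e1 : ∑ j ∈ Finset.univ.erase i, (M.Y (g j) (w j) p₁ - M.Y (g j) (w j) q₁) - V (H.symm x) =
      (∑ j, (M.Y (g j) (w j) p₁ - M.Y (g j) (w j) q₁) - V ((n : ℝ) • d)) +
      (V ((n : ℝ) • d) - V (H.symm x)) - (M.Y (g i) (w i) p₁ - M.Y (g i) (w i) q₁) := by
    rw [← hsum]; ring
  rw [e1]
  refine (abs_sub _ _).trans ((add_le_add ((abs_add_le _ _).trans (add_le_add hYV hVV)) hown).trans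
    (le_of_eq ?_))
  ring

end Market

/-! ### Convergence of the direct and indirect effects. -/

namespace Market

section

variable {J : ℕ} {𝒢 Ω : Type*} {M : Market J 𝒢} {l u : Price J} [MeasurableSpace 𝒢] {Θ : Measure 𝒢}
  [IsProbabilityMeasure Θ] [MeasurableSpace Ω] {μ : Measure Ω} [IsProbabilityMeasure μ]
  {G : ℕ → Ω → 𝒢} {π : ℝ} {P : (n : ℕ) → (Fin n → 𝒢) → (Fin n → Bool) → Price J}

/-- The average direct effect converges in probability. -/
theorem IsPriceRule.tendsto_tauADE (hP : M.IsPriceRule P) (hM : M.IsMeasurable)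
    (hb : M.HasPriceBounds Θ l u) (hs : M.Smooth l u)
    (hGm : ∀ i, Measurable (G i)) (hGlaw : ∀ i, μ.map (G i) = Θ) (hGindep : iIndepFun G μ)
    (hπ : π ∈ Set.Icc (0 : ℝ) 1) {κ : ℝ} (hκ1 : κ < 1)
    (hκ : ∀ p ∈ priceBox l u, ∀ q ∈ priceBox l u,
        ‖M.meanExcess Θ π p + p - (M.meanExcess Θ π q + q)‖ ≤ κ * ‖p - q‖)
    {p₀ : Price J} (hp₀ : p₀ ∈ priceBox l u) (hz : M.meanExcess Θ π p₀ = 0) :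
    Tendsto (fun a : ℕ × Ω => M.tauADE P π fun i : Fin a.1 => G i a.2) (inProbability μ)
      (𝓝 (M.meanY Θ true p₀ - M.meanY Θ false p₀)) := by
  obtain ⟨C, hC0, hC⟩ := hs.exists_uniformC2
  have hY := fun b => (hC b).1
  have hL := tendsto_fst_inProbability μ
  have hL' := tendsto_fst_treatmentFilter (inProbability μ) hπ
  have hbox := hP.eventually_mem_priceBox hb hs hGm hGlaw hGindep
  let f : ∀ a : ℕ × Ω, (Fin a.1 → Bool) → ℝ := fun a w => (a.1 : ℝ)⁻¹ • ∑ i : Fin a.1,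
    (M.Y (G i a.2) true (P a.1 (fun i => G i a.2) (Function.update w i true)) -
      M.Y (G i a.2) false (P a.1 (fun i => G i a.2) (Function.update w i false)))
  have htau : ∀ a : ℕ × Ω, treatmentExp π (f a) = M.tauADE P π fun i : Fin a.1 => G i a.2 := by
    intro a
    simp only [f, smul_eq_mul, tauADE]
    rw [treatmentExp_const_mul, treatmentExp_sum]
  have hbound : ∀ᶠ a in inProbability μ, ∀ w, |f a w| ≤ 2 * C * a.1 := by
    filter_upwards [hbox, hL.eventually (eventually_ge_atTop 1)] with a ha hn w
    have hn' : (1 : ℝ) ≤ a.1 := by exact_mod_cast hn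
    have : |f a w| ≤ 2 * C := by
      rw [← Real.norm_eq_abs]
      refine norm_average_le (by positivity) fun i => (norm_sub_le _ _).trans ?_
      have k1 := (hY true).norm_le (G i a.2) _ (ha (Function.update w i true))
      have k2 := (hY false).norm_le (G i a.2) _ (ha (Function.update w i false))
      linarith
    nlinarith
  have hmean := tendsto_sampleMean hGm hGlaw hGindep
    (X := fun g => M.Y g true p₀ - M.Y g false p₀) (C := 2 * C)
    ((hM.measurable_Y true p₀).sub (hM.measurable_Y false p₀))
    (fun g => (norm_sub_le _ _).trans (by
      have k1 := (hY true).norm_le g p₀ hp₀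
      have k2 := (hY false).norm_le g p₀ hp₀
      linarith))
  rw [integral_sub ((hY true).integrable (hM.measurable_Y true) hp₀)
    ((hY false).integrable (hM.measurable_Y false) hp₀)] at hmean
  have hdiff : Tendsto (fun t : Σ a : ℕ × Ω, Fin a.1 → Bool => f t.1 t.2 -
      (t.1.1 : ℝ)⁻¹ • ∑ i : Fin t.1.1, (M.Y (G i t.1.2) true p₀ - M.Y (G i t.1.2) false p₀))
      (treatmentFilter (inProbability μ) hπ) (𝓝 0) := by
    rw [Metric.tendsto_nhds]
    intro ε hε
    filter_upwards [hL'.eventually hbox, hP.eventually_norm_price_sub_le hM hb hs hGm hGlaw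
      hGindep hκ1 hκ hp₀ hz (show 0 < ε / (4 * (C + 1)) by positivity)] with t ht hp
    rw [dist_zero_right]
    refine lt_of_le_of_lt ?_ (half_lt_self hε)
    simp only [f]
    rw [← smul_sub, ← Finset.sum_sub_distrib]
    refine norm_average_le (by positivity) fun i => ?_
    rw [sub_sub_sub_comm]
    refine (norm_sub_le _ _).trans ?_
    have k : ∀ b, ‖M.Y (G i t.1.2) b (P t.1.1 (fun i => G i t.1.2) (Function.update t.2 i b)) -
        M.Y (G i t.1.2) b p₀‖ ≤ ε / 4 := by
      intro b
      have k1 := (hY b).norm_sub_le_mul (convex_priceBox l u) (G i t.1.2)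
        (ht (Function.update t.2 i b)) hp₀
      have k2 := hp i b
      rw [le_div_iff₀ (by positivity)] at k2
      refine k1.trans ?_
      nlinarith [norm_nonneg (P t.1.1 (fun i => G i t.1.2) (Function.update t.2 i b) - p₀)]
    linarith [k true, k false]
  have hf := hdiff.add (hmean.comp hL')
  rw [zero_add] at hf
  have := tendsto_treatmentExp hL hπ f (hf.congr fun t => by simp [Function.comp]) hbound
  exact this.congr htau

/-- The average indirect effect converges in probability. -/
theorem IsPriceRule.tendsto_tauAIE (hP : M.IsPriceRule P) (hM : M.IsMeasurable)
    (hb : M.HasPriceBounds Θ l u) (hs : M.Smooth l u)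
    (hGm : ∀ i, Measurable (G i)) (hGlaw : ∀ i, μ.map (G i) = Θ) (hGindep : iIndepFun G μ)
    (hπ : π ∈ Set.Icc (0 : ℝ) 1) {κ : ℝ} (hκ1 : κ < 1)
    (hκ : ∀ p ∈ priceBox l u, ∀ q ∈ priceBox l u,
        ‖M.meanExcess Θ π p + p - (M.meanExcess Θ π q + q)‖ ≤ κ * ‖p - q‖)
    {p₀ : Price J} (hp₀ : p₀ ∈ priceBox l u) (hz : M.meanExcess Θ π p₀ = 0)
    {H : Price J ≃L[ℝ] Price J}
    (hH : (H : Price J →L[ℝ] Price J) = -M.meanJacobian Θ π p₀) :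
    Tendsto (fun a : ℕ × Ω => M.tauAIE P π fun i : Fin a.1 => G i a.2) (inProbability μ)
      (𝓝 ((π • (∫ g, fderiv ℝ (M.Y g true) p₀ ∂Θ) + (1 - π) • ∫ g, fderiv ℝ (M.Y g false) p₀ ∂Θ)
        (H.symm (M.meanExcessAt Θ true p₀ - M.meanExcessAt Θ false p₀)))) := by
  obtain ⟨C, hC0, hC⟩ := hs.exists_uniformC2
  have hY := fun b => (hC b).1
  have hZ := fun b => (hC b).2.2.2
  have hL := tendsto_fst_inProbability μ
  have hL' := tendsto_fst_treatmentFilter (inProbability μ) hπ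
  have hbox := hP.eventually_mem_priceBox hb hs hGm hGlaw hGindep
  set V := π • (∫ g, fderiv ℝ (M.Y g true) p₀ ∂Θ) + (1 - π) • ∫ g, fderiv ℝ (M.Y g false) p₀ ∂Θ
    with hV
  let N := ‖(H.symm : Price J →L[ℝ] Price J)‖
  let K := (C + 1) * (12 * N * C) + ‖V‖ * (N * (4 * C + (C + 1) * (12 * N * C))) + 2 * C
  have hK : 0 ≤ K := by positivity
  let L : Price J →L[ℝ] ℝ := V.comp (H.symm : Price J →L[ℝ] Price J)
  let f : ∀ a : ℕ × Ω, (Fin a.1 → Bool) → ℝ := fun a w => (a.1 : ℝ)⁻¹ • ∑ i : Fin a.1,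
    ∑ j ∈ Finset.univ.erase i,
    (M.Y (G j a.2) (w j) (P a.1 (fun i => G i a.2) (Function.update w i true)) -
      M.Y (G j a.2) (w j) (P a.1 (fun i => G i a.2) (Function.update w i false)))
  have htau : ∀ a : ℕ × Ω, treatmentExp π (f a) = M.tauAIE P π fun i : Fin a.1 => G i a.2 := by
    intro a
    simp only [f, smul_eq_mul, tauAIE]
    rw [treatmentExp_const_mul, treatmentExp_sum]
    simp_rw [treatmentExp_sum]
  -- Each of up to `n` other agents contributes at most `2 * C`. This linear growth is why
  -- exceptional assignments must have probability `o(1 / n)`.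
  have hbound : ∀ᶠ a in inProbability μ, ∀ w, |f a w| ≤ 2 * C * a.1 := by
    filter_upwards [hbox] with a ha w
    rw [← Real.norm_eq_abs]
    refine norm_average_le (by positivity) fun i => ?_
    have k : ∀ j ∈ Finset.univ.erase i,
        ‖M.Y (G j a.2) (w j) (P a.1 (fun i => G i a.2) (Function.update w i true)) -
        M.Y (G j a.2) (w j) (P a.1 (fun i => G i a.2) (Function.update w i false))‖ ≤ 2 * C := by
      intro j _
      have k1 := (hY (w j)).norm_le (G j a.2) _ (ha (Function.update w i true))
      have k2 := (hY (w j)).norm_le (G j a.2) _ (ha (Function.update w i false))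
      exact (norm_sub_le _ _).trans (by linarith)
    refine (norm_sum_le_of_le _ k).trans ?_
    rw [Finset.sum_const, nsmul_eq_mul, mul_comm]
    refine mul_le_mul_of_nonneg_left ?_ (by positivity)
    exact_mod_cast (Finset.card_le_univ _).trans (Fintype.card_fin _).le
  have hmean := tendsto_sampleMean hGm hGlaw hGindep
    (X := fun g => L (M.excess g true p₀ - M.excess g false p₀)) (C := ‖L‖ * (2 * C))
    (L.continuous.measurable.comp ((hM.excess true p₀).sub (hM.excess false p₀)))
    (fun g => (L.le_opNorm _).trans (mul_le_mul_of_nonneg_left ((norm_sub_le _ _).trans (by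
      have k1 := (hZ true).norm_le g p₀ hp₀
      have k2 := (hZ false).norm_le g p₀ hp₀
      linarith)) (norm_nonneg _)))
  have hZint : ∀ b, Integrable (fun g => M.excess g b p₀) Θ := fun b =>
    (hZ b).integrable (hM.excess b) hp₀
  rw [L.integral_comp_comm (φ := fun g => M.excess g true p₀ - M.excess g false p₀)
      ((hZint true).sub (hZint false)),
    integral_sub (hZint true) (hZint false)] at hmean
  have hDZ := tendsto_treatmentAverage hGm hGlaw hGindep hπ
    (X := fun b g => fderiv ℝ (M.excess g b) p₀)
    (fun b => measurable_fderiv_family (hM.excess b) fun g => (hZ b).differentiableAt g p₀)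
    (fun b g => (hZ b).norm_fderiv_le g p₀ hp₀)
  have hDY := tendsto_treatmentAverage hGm hGlaw hGindep hπ
    (X := fun b g => fderiv ℝ (M.Y g b) p₀)
    (fun b => measurable_fderiv_family (hM.measurable_Y b) fun g => (hY b).differentiableAt g p₀)
    (fun b g => (hY b).norm_fderiv_le g p₀ hp₀)
  have hJ : π • (∫ g, fderiv ℝ (M.excess g true) p₀ ∂Θ) +
      (1 - π) • (∫ g, fderiv ℝ (M.excess g false) p₀ ∂Θ) = -(H : Price J →L[ℝ] Price J) := by
    rw [hH, neg_neg, meanJacobian]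
  rw [hJ] at hDZ
  rw [← hV] at hDY
  have hdiff : Tendsto (fun t : Σ a : ℕ × Ω, Fin a.1 → Bool => f t.1 t.2 - (t.1.1 : ℝ)⁻¹ •
      ∑ i : Fin t.1.1, L (M.excess (G i t.1.2) true p₀ - M.excess (G i t.1.2) false p₀))
      (treatmentFilter (inProbability μ) hπ) (𝓝 0) := by
    rw [Metric.tendsto_nhds]
    intro ε hε
    -- The entries serve, in order, the hypotheses `he1` and `heN` of `abs_sum_erase_sub_le` and the
    -- final bound `K * e < ε`.
    let e := min 1 (min (1 / (2 * (N * (C + 1) + 1))) (ε / (2 * (K + 1))))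
    have he : 0 < e := lt_min one_pos (lt_min (by positivity) (by positivity))
    have he1 : e ≤ 1 := min_le_left _ _
    have heN : N * ((C + 1) * e) ≤ 1 / 2 := by
      have h : e ≤ 1 / (2 * (N * (C + 1) + 1)) := (min_le_right _ _).trans (min_le_left _ _)
      rw [le_div_iff₀ (by positivity)] at h
      nlinarith
    have heK : K * e < ε := by
      have h : e ≤ ε / (2 * (K + 1)) := (min_le_right _ _).trans (min_le_right _ _)
      rw [le_div_iff₀ (by positivity)] at h
      nlinarith
    filter_upwards [hL'.eventually hbox, hP.eventually_norm_price_sub_le hM hb hs hGm hGlaw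
      hGindep hκ1 hκ hp₀ hz he, Metric.tendsto_nhds.1 hDZ e he, Metric.tendsto_nhds.1 hDY e he]
      with t ht hp hA hB
    rw [dist_eq_norm, sub_neg_eq_add] at hA
    rw [dist_eq_norm] at hB
    rw [dist_zero_right]
    refine lt_of_le_of_lt ?_ heK
    simp only [f]
    rw [← smul_sub, ← Finset.sum_sub_distrib]
    refine norm_average_le (by positivity) fun i => ?_
    exact abs_sum_erase_sub_le hC0 hY hZ H V (fun i : Fin t.1.1 => G i t.1.2) t.2 i hp₀
      (ht _) (ht _) he1 heN (hp i true) (hp i false) hA.le hB.le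
      (hP.avgExcess_eq_zero hb hs _ _) (hP.avgExcess_eq_zero hb hs _ _)
  have hf := hdiff.add (hmean.comp hL')
  rw [zero_add] at hf
  have := tendsto_treatmentExp hL hπ f (hf.congr fun t => by simp [Function.comp]) hbound
  exact this.congr htau

end

end Market

/-! ### The main theorem. -/

theorem theorem1 {J : ℕ} {𝒢 Ω : Type*} [MeasurableSpace 𝒢] [MeasurableSpace Ω]
    -- the agents and the distribution they are drawn from
    (M : Market J 𝒢) (Θ : Measure 𝒢) [IsProbabilityMeasure Θ] (hM : M.IsMeasurable)
    (l u : Price J) (hbounds : M.HasPriceBounds Θ l u) (hsmooth : M.Smooth l u)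
    -- the treatment probability
    (π : ℝ) (hπ0 : 0 < π) (hπ1 : π < 1)
    (hcontr : ∀ p ∈ priceBox l u,
      ‖fderivWithin ℝ (fun q => M.meanExcess Θ π q + q) (priceBox l u) p‖ < 1)
    -- the finite-sample market prices
    (P : (n : ℕ) → (Fin n → 𝒢) → (Fin n → Bool) → Price J) (hP : M.IsPriceRule P)
    -- an i.i.d. sample of agents
    (μ : Measure Ω) [IsProbabilityMeasure μ] (G : ℕ → Ω → 𝒢) (hGm : ∀ i, Measurable (G i))
    (hGlaw : ∀ i, μ.map (G i) = Θ) (hGindep : iIndepFun G μ) :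
    -- the mean-field price exists and is unique near `π`
    (∀ᶠ q in 𝓝 π, ∃! p, M.IsMeanFieldPrice Θ q p) ∧
    ∀ pstar : ℝ → Price J, (∀ᶠ q in 𝓝 π, M.IsMeanFieldPrice Θ q (pstar q)) →
      -- the expectations below exist near the mean-field price
      (∀ᶠ p in 𝓝 (pstar π), ∀ w, Integrable (fun g => M.Y g w p) Θ ∧
        Integrable (fun g => M.D g w p) Θ ∧ Integrable (fun g => M.S g w p) Θ) ∧
      -- `dp` is the derivative of the mean-field price, `v` the price gradient of the expected
      -- outcome, `H` minus the price Jacobian and `b` the `π`-derivative of the excess demand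
      ∃ (dp v b : Price J) (H : Price J ≃L[ℝ] Price J),
        HasDerivAt pstar dp π ∧
        HasGradientAt (fun p => π * M.meanY Θ true p + (1 - π) * M.meanY Θ false p) v (pstar π) ∧
        HasFDerivAt (M.meanExcess Θ π) (-(H : Price J →L[ℝ] Price J)) (pstar π) ∧
        HasDerivAt (fun q => M.meanExcess Θ q (pstar π)) b π ∧
        b = M.meanD Θ true (pstar π) - M.meanD Θ false (pstar π) -
          (M.meanS Θ true (pstar π) - M.meanS Θ false (pstar π)) ∧
        dp = H.symm b ∧
        TendstoInMeasure μ (fun n ω => M.tauADE P π fun i : Fin n => G i ω) atTop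
          (fun _ => M.meanY Θ true (pstar π) - M.meanY Θ false (pstar π)) ∧
        TendstoInMeasure μ (fun n ω => M.tauAIE P π fun i : Fin n => G i ω) atTop
          (fun _ => inner ℝ v dp) := by

  refine ⟨Market.eventually_existsUnique_isMeanFieldPrice hM hbounds hsmooth hπ0 hπ1 hcontr,
    fun pstar hpstar => ?_⟩
  obtain ⟨κ, hκ0, hκ1, hκJ, hκ⟩ := hsmooth.exists_contraction hM hbounds hcontr
  obtain ⟨C, hC0, hC⟩ := hsmooth.exists_uniformC2
  have hp := hpstar.self_of_nhds
  have hint := hp.lower_lt_and_lt_upper hbounds hπ0 hπ1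
  have hbox : pstar π ∈ priceBox l u := fun j => ⟨(hint j).1.le, (hint j).2.le⟩
  -- The mean-field price is interior, which turns derivatives within the box into full derivatives.
  have hnhds : priceBox l u ∈ 𝓝 (pstar π) := priceBox_mem_nhds hint
  have hπ : π ∈ Set.Icc (0 : ℝ) 1 := ⟨hπ0.le, hπ1.le⟩
  -- Minus the Jacobian is the identity minus an operator of norm below one, so a Neumann series
  -- inverts it.
  let H : Price J ≃L[ℝ] Price J := ContinuousLinearEquiv.unitsEquiv ℝ (Price J)
    (Units.oneSub (M.meanJacobian Θ π (pstar π) + 1) ((hκJ _ hbox).trans_lt hκ1))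
  have hH : (H : Price J →L[ℝ] Price J) = -M.meanJacobian Θ π (pstar π) := by
    have : (H : Price J →L[ℝ] Price J) = 1 - (M.meanJacobian Θ π (pstar π) + 1) := rfl
    rw [this]; abel
  let V : Price J →L[ℝ] ℝ := π • (∫ g, fderiv ℝ (M.Y g true) (pstar π) ∂Θ) +
    (1 - π) • ∫ g, fderiv ℝ (M.Y g false) (pstar π) ∂Θ
  let b := M.meanExcessAt Θ true (pstar π) - M.meanExcessAt Θ false (pstar π)
  have hb : ∀ w, M.meanExcessAt Θ w (pstar π) = M.meanD Θ w (pstar π) - M.meanS Θ w (pstar π) :=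
    fun w => Market.meanExcessAt_eq (hp.1 w).1 (hp.1 w).2
  refine ⟨?_, H.symm b, (InnerProductSpace.toDual ℝ (Price J)).symm V, b, H, ?_, ?_, ?_, ?_, ?_,
    rfl, ?_, ?_⟩
  · filter_upwards [hnhds] with p hpbox w
    exact ⟨(hC w).1.integrable (hM.measurable_Y w) hpbox, hsmooth.integrable hM hpbox w⟩
  · exact Market.hasDerivAt_meanFieldPrice hM hbounds hsmooth hπ0 hπ1 hκ1 hκ hpstar hH
  · have h : ∀ w, HasFDerivAt (M.meanY Θ w) (∫ g, fderiv ℝ (M.Y g w) (pstar π) ∂Θ) (pstar π) :=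
      fun w => ((hC w).1.hasFDerivWithinAt_integral (hM.measurable_Y w) (convex_priceBox l u)
        hbox).hasFDerivAt hnhds
    rw [hasGradientAt_iff_hasFDerivAt, LinearIsometryEquiv.apply_symm_apply]
    exact ((h true).const_mul π).add ((h false).const_mul (1 - π))
  · rw [hH, neg_neg]
    exact (hsmooth.hasFDerivWithinAt_meanExcess hM π hbox).hasFDerivAt hnhds
  · have h := ((hasDerivAt_id π).smul_const (M.meanExcessAt Θ true (pstar π))).add
      (((hasDerivAt_id π).const_sub 1).smul_const (M.meanExcessAt Θ false (pstar π)))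
    have e : (1 : ℝ) • M.meanExcessAt Θ true (pstar π) +
        (-1 : ℝ) • M.meanExcessAt Θ false (pstar π) = b := by
      simp only [b]; module
    rw [e] at h
    exact h.congr_of_eventuallyEq (Eventually.of_forall fun q => Market.meanExcess_eq hp.1)
  · simp only [b, hb]; abel
  · exact tendstoInMeasure_iff_inProbability.2 (hP.tendsto_tauADE hM hbounds hsmooth hGm hGlaw
      hGindep hπ hκ1 hκ hbox hp.2)
  · rw [InnerProductSpace.toDual_symm_apply]
    exact tendstoInMeasure_iff_inProbability.2 (hP.tendsto_tauAIE hM hbounds hsmooth hGm hGlaw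
      hGindep hπ hκ1 hκ hbox hp.2 hH)
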